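/- **Definitions.** A *Morse tile* $T$ of dimension $n\ge 0$ and order $k\in\{0,\dots,n+1\}$ is a closed $n$-simplex $\overline T$ deprived of $k$ of its codimension one faces (for $n=0$ the empty face counts as the only one) together with, if $k\ge 1$, one possibly empty face $\mu$ of codimension at least two, which, if nonempty, is not contained in a removed codimension one face. The tile is *critical of index $k$* if it is a closed simplex ($k=0$), or if it has order $k$ and $\mu$ is nonempty of dimension $k-1$, or if it is an open simplex of dimension $k$. A *Morse tiling* of a finite simplicial complex $K$ is a finite partition of its geometric realization $|K|$ by Morse tiles such that for every $j\ge 0$ the union of the tiles of dimension greater than $j$ is closed. A *Morse shelling* is a Morse tiling together with an ordering $T_1,\dots,T_N$ of its tiles such that $T_1\cup\dots\cup T_p$ is closed in $|K|$ for every $p$; let $K_p$ be the subcomplex of $K$ made of the simplices contained in $T_1\cup\dots\cup T_p$, so that $\emptyset=K_0\subset K_1\subset\dots\subset K_N=K$, and put $K_p=\emptyset$ for $p<0$ and $K_p=K$ for $p>N$. **Theorem.** Let $K$ be a finite simplicial complex with a Morse shelling $T_1,\dots,T_N$, let $R$ be a commutative ring and let $M$ be an $R$-module (for instance $R=\mathbb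 Z$ and $M$ any abelian group). Simplicial chains and cochains are taken with coefficients in $M$. 1. The spectral sequence of $R$-modules $(E^r_{p,q},d^r)_{r\ge 0}$, $d^r:E^r_{p,q}\to E^r_{p-r,q+r-1}$, induced by the increasing filtration of $C_*(K;M)$ by the subcomplexes $C_*(K_p;M)$ satisfies $d^r=0$ for $r\ge N$ and converges to $H_*(K;M)$: for every $r\ge N$ and all $p,q\in\mathbb Z$, $$E^r_{p,q}\cong \Phi_pH_{p+q}(K;M)/\Phi_{p-1}H_{p+q}(K;M),$$ where $\Phi_pH_*(K;M)$ is the image of $H_*(K_p;M)\to H_*(K;M)$. Its first page is $$E^1_{p,q}\cong M\ \text{ if } 1\le p\le N \text{ and } T_p \text{ is critical of index } p+q,\qquad E^1_{p,q}=0\ \text{ otherwise.}$$ 2. The spectral sequence of $R$-modules $(E_r^{p,q},d_r)_{r\ge 0}$, $d_r:E_r^{p,q}\to E_r^{p+r,q-r+1}$, induced by the decreasing filtration of $C^*(K;M)$ by the subcomplexes $C^*(K,K_p;M)$ of cochains vanishing on $K_p$ satisfies $d_r=0$ for $r\ge N$ and converges to $H^*(K;M)$: for every $r\ge N$ and all $p,q\in\mathbb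 Z$, $$E_r^{p,q}\cong \Phi^pH^{p+q}(K;M)/\Phi^{p+1}H^{p+q}(K;M),$$ where $\Phi^pH^*(K;M)$ is the image of $H^*(K,K_p;M)\to H^*(K;M)$. Its first page is $$E_1^{p,q}\cong M\ \text{ if } 0\le p\le N-1 \text{ and } T_{p+1} \text{ is critical of index } p+q,\qquad E_1^{p,q}=0\ \text{ otherwise.}$$ In particular, for $M=R$ both first pages are free graded modules on the critical tiles, a critical tile of index $k$ contributing one generator in total degree $k$. -/

import Mathlib

open CategoryTheory

universe u v w

noncomputable section

/-! ### Simplicial complexes and their geometric realizations -/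

section Geometry

variable {V : Type u} [DecidableEq V]

/-- The closed simplex spanned by the finite set of vertices `s`, in barycentric coordinates.
It is empty when `s` is empty. -/
def closedSimplex (s : Finset V) : Set (V → ℝ) :=
  {x | (∀ v, 0 ≤ x v) ∧ (∀ v, v ∉ s → x v = 0) ∧ ∑ v ∈ s, x v = 1}

/-- The geometric realization of a simplicial complex, a subspace of `V → ℝ`. -/
def PreAbstractSimplicialComplex.realization (K : PreAbstractSimplicialComplex V) :
    Set (V → ℝ) :=
  ⋃ s ∈ K.faces, closedSimplex s

/-- The subset `A` of the geometric realization of `K` is closed in it. -/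
def PreAbstractSimplicialComplex.IsClosedIn (K : PreAbstractSimplicialComplex V)
    (A : Set (V → ℝ)) : Prop :=
  IsClosed ((↑) ⁻¹' A : Set K.realization)

/-- The subcomplex of `K` made of all its simplices which are contained in the set `A`. -/
def PreAbstractSimplicialComplex.within (K : PreAbstractSimplicialComplex V)
    (A : Set (V → ℝ)) : PreAbstractSimplicialComplex V where
  faces := {s | s ∈ K.faces ∧ closedSimplex s ⊆ A}
  isRelLowerSet_faces := by
    rintro s ⟨hs, hA⟩
    refine ⟨(K.isRelLowerSet_faces hs).1, fun t hts ht => ?_⟩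
    refine ⟨(K.isRelLowerSet_faces hs).2 hts ht, fun x hx => hA ⟨hx.1, ?_, ?_⟩⟩
    · exact fun v hv => hx.2.1 v fun h => hv (hts h)
    · rw [← hx.2.2]
      exact (Finset.sum_subset hts fun v _ hv => hx.2.1 v hv).symm

variable (V) in
/-- A Morse tile: a simplex deprived of some of its facets together with, if at least one facet
is removed, a possibly empty face of codimension at least two, its Morse face.
A facet is recorded by the vertex of the simplex opposite to it. A nonempty Morse face is not
contained in a removed facet (otherwise removing it would change nothing), which means that it
contains all the vertices opposite to the removed facets. -/
structure MorseTile where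
  /-- the vertices of the underlying simplex -/
  simplex : Finset V
  simplex_nonempty : simplex.Nonempty
  /-- the vertices opposite to the removed facets -/
  opposite : Finset V
  opposite_subset : opposite ⊆ simplex
  /-- the vertices of the Morse face -/
  morseFace : Finset V
  morseFace_subset : morseFace ⊆ simplex
  opposite_nonempty : morseFace.Nonempty → opposite.Nonempty
  opposite_subset_morseFace : morseFace.Nonempty → opposite ⊆ morseFace
  codim_morseFace : morseFace.Nonempty → morseFace.card + 2 ≤ simplex.card

namespace MorseTile

/-- The dimension of the underlying simplex. -/
def dim (T : MorseTile V) : ℤ := (T.simplex.card : ℤ) - 1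

/-- The order of a tile is the number of removed facets. -/
def order (T : MorseTile V) : ℕ := T.opposite.card

/-- The tile as a subset of the geometric realization: the underlying closed simplex deprived of
the facets and of the Morse face. -/
def carrier (T : MorseTile V) : Set (V → ℝ) :=
  closedSimplex T.simplex \
    ((⋃ v ∈ T.opposite, closedSimplex (T.simplex.erase v)) ∪ closedSimplex T.morseFace)

/-- Critical tiles of index `k`: closed simplices (with `k = 0`), tiles of order `k` with a Morse
face of dimension `k - 1`, and open simplices of dimension `k`. -/
def IsCritical (T : MorseTile V) (k : ℤ) : Prop :=
  (T.order = 0 ∧ k = 0) ∨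
  (T.morseFace.Nonempty ∧ k = T.order ∧ (T.morseFace.card : ℤ) - 1 = k - 1) ∨
  (T.opposite = T.simplex ∧ k = T.dim)

end MorseTile

/-- A Morse tiling of a simplicial complex by finitely many tiles, numbered arbitrarily:
a partition of the geometric realization by Morse tiles such that for every `j ≥ 0` the union of
the tiles of dimension greater than `j` is closed. -/
structure MorseTiling (K : PreAbstractSimplicialComplex V) where
  /-- the number of tiles -/
  numTiles : ℕ
  /-- the tiles -/
  tile : Fin numTiles → MorseTile V
  disjoint : ∀ i j, i ≠ j → Disjoint (tile i).carrier (tile j).carrier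
  cover : ⋃ i, (tile i).carrier = K.realization
  closed_of_dim : ∀ j : ℕ, K.IsClosedIn (⋃ (i) (_ : (j : ℤ) < (tile i).dim), (tile i).carrier)

/-- The union of the first `p` tiles of a numbered tiling. -/
def MorseTiling.initial {K : PreAbstractSimplicialComplex V} (S : MorseTiling K) (p : ℤ) :
    Set (V → ℝ) :=
  ⋃ (i) (_ : (i.val : ℤ) < p), (S.tile i).carrier

/-- A Morse shelling: a Morse tiling whose tiles are numbered in such a way that the unions of the
first tiles are closed, so that they form a filtration by closed subsets whose successive
differences are the tiles. -/
structure MorseShelling (K : PreAbstractSimplicialComplex V) extends MorseTiling K where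
  closed_initial : ∀ p : ℕ, p ≤ numTiles → K.IsClosedIn (toMorseTiling.initial p)

/-- The filtration `∅ = K₀ ⊆ K₁ ⊆ … ⊆ K_N = K` by subcomplexes given by a Morse shelling,
extended to all integers by `∅` and `K`. -/
def MorseShelling.subcomplex {K : PreAbstractSimplicialComplex V} (S : MorseShelling K) (p : ℤ) :
    PreAbstractSimplicialComplex V :=
  K.within (S.initial p)

end Geometry

/-! ### Simplicial chains and cochains -/

section Chains

variable {V : Type u} [LinearOrder V]

/-- The `n`-dimensional simplices of `K`. -/
abbrev PreAbstractSimplicialComplex.Simplex (K : PreAbstractSimplicialComplex V) (n : ℤ) : Type u :=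
  {s : Finset V // s ∈ K.faces ∧ (s.card : ℤ) = n + 1}

/-- The incidence sign of the facet of `s` opposite to `v`, simplices being oriented by the
order on the vertices. -/
def incidence (s : Finset V) (v : V) : ℤ := (-1) ^ (s.filter (· < v)).card

lemma incidence_anticomm (s : Finset V) {v w : V} (hv : v ∈ s) (hw : w ∈ s) (hvw : v ≠ w) :
    incidence s v * incidence (s.erase v) w = -(incidence s w * incidence (s.erase w) v) := by
  wlog h : v < w generalizing v w
  · have h' : w < v := lt_of_le_of_ne (not_lt.mp h) (Ne.symm hvw)
    rw [this hw hv (Ne.symm hvw) h', neg_neg]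
  have h1 : (s.erase w).filter (· < v) = s.filter (· < v) := by
    ext x
    simp only [Finset.mem_filter, Finset.mem_erase]
    exact ⟨fun a => ⟨a.1.2, a.2⟩, fun a => ⟨⟨(a.2.trans h).ne, a.1⟩, a.2⟩⟩
  have h2 : (s.filter (· < w)).card = ((s.erase v).filter (· < w)).card + 1 := by
    rw [Finset.filter_erase, Finset.card_erase_add_one]
    exact Finset.mem_filter.mpr ⟨hv, h⟩
  simp only [incidence, h1, h2, pow_succ]
  ring

variable (R : Type w) [CommRing R] (M : Type v) [AddCommGroup M] [Module R M]
variable (K : PreAbstractSimplicialComplex V)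

open Classical in
/-- `M`-valued function on finite sets, extending by zero a function on the `n`-simplices. -/
def extendCochain (n : ℤ) (f : K.Simplex n → M) (t : Finset V) : M :=
  if h : t ∈ K.faces ∧ (t.card : ℤ) = n + 1 then f ⟨t, h⟩ else 0

open Classical in
/-- The elementary chain with coefficient `m` on `t`, or zero if `t` is not an `n`-simplex of
`K`. -/
def elementaryChain (n : ℤ) (t : Finset V) : M →ₗ[R] (K.Simplex n →₀ M) :=
  if h : t ∈ K.faces ∧ (t.card : ℤ) = n + 1 then Finsupp.lsingle ⟨t, h⟩ else 0

lemma elementaryChain_eq_zero {n : ℤ} {t : Finset V} (h : (t.card : ℤ) ≠ n + 1) :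
    elementaryChain R M K n t = 0 :=
  dif_neg fun h' => h h'.2

/-- The simplicial boundary `m s ↦ ∑ v ∈ s, ± m (s \ {v})`, from `i`-chains to `j`-chains; it
vanishes unless `i = j + 1`. -/
def simplicialBoundary (i j : ℤ) : (K.Simplex i →₀ M) →ₗ[R] (K.Simplex j →₀ M) :=
  Finsupp.lsum ℕ fun s => ∑ v ∈ s.1, incidence s.1 v • elementaryChain R M K j (s.1.erase v)

/-- The simplicial coboundary `f ↦ (t ↦ ∑ v ∈ t, ± f (t \ {v}))`, from `i`-cochains to
`j`-cochains; it vanishes unless `j = i + 1`. -/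
def simplicialCoboundary (i j : ℤ) : (K.Simplex i → M) →ₗ[R] (K.Simplex j → M) where
  toFun f t := ∑ v ∈ t.1, incidence t.1 v • extendCochain M K i f (t.1.erase v)
  map_add' f g := by
    ext t
    simp only [Pi.add_apply, ← Finset.sum_add_distrib]
    refine Finset.sum_congr rfl fun v _ => ?_
    unfold extendCochain
    split_ifs
    · exact smul_add _ _ _
    · simp
  map_smul' c f := by
    ext t
    simp only [Pi.smul_apply, RingHom.id_apply, Finset.smul_sum]
    refine Finset.sum_congr rfl fun v _ => ?_
    unfold extendCochain
    split_ifs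
    · exact smul_comm _ _ _
    · simp

variable {K}

lemma simplex_erase {i : ℤ} (s : K.Simplex i) {v : V} (hv : v ∈ s.1) :
    ((s.1.erase v).card : ℤ) = i := by
  have h := s.2.2
  rw [← Finset.card_erase_add_one hv] at h
  push_cast at h
  linarith

/-- Sums over ordered pairs of distinct vertices of a term depending on the set of the remaining
vertices only cancel, when weighted by incidence signs. -/
lemma sum_incidence_eq_zero {A : Type*} [AddCommGroup A] (s : Finset V) (g : Finset V → A) :
    ∑ v ∈ s, ∑ w ∈ s.erase v,
      (incidence s v * incidence (s.erase v) w) • g ((s.erase v).erase w) = 0 := by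
  rw [Finset.sum_sigma']
  refine Finset.sum_involution (fun x _ => ⟨x.2, x.1⟩) ?_ ?_ ?_ ?_
  · rintro ⟨v, w⟩ h
    simp only [Finset.mem_sigma, Finset.mem_erase] at h
    rw [incidence_anticomm s h.1 h.2.2 (Ne.symm h.2.1), Finset.erase_right_comm, neg_smul,
      neg_add_cancel]
  · rintro ⟨v, w⟩ h _ he
    simp only [Finset.mem_sigma, Finset.mem_erase] at h
    exact h.2.1 (congrArg Sigma.fst he)
  · rintro ⟨v, w⟩ h
    simp only [Finset.mem_sigma, Finset.mem_erase] at h ⊢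
    exact ⟨h.2.2, Ne.symm h.2.1, h.1⟩
  · rintro ⟨v, w⟩ _
    rfl

variable (K)

lemma simplicialBoundary_comp (i j k : ℤ) (hij : j + 1 = i) :
    simplicialBoundary R M K j k ∘ₗ simplicialBoundary R M K i j = 0 := by
  refine Finsupp.lhom_ext fun s m => ?_
  have key : ∀ v ∈ s.1, simplicialBoundary R M K j k
      (elementaryChain R M K j (s.1.erase v) m) =
      ∑ w ∈ s.1.erase v, incidence (s.1.erase v) w •
        elementaryChain R M K k ((s.1.erase v).erase w) m := by
    intro v hv
    by_cases h : s.1.erase v ∈ K.faces ∧ ((s.1.erase v).card : ℤ) = j + 1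
    · rw [elementaryChain, dif_pos h, simplicialBoundary, Finsupp.lsingle_apply,
        Finsupp.lsum_single]
      simp only [LinearMap.sum_apply, LinearMap.smul_apply]
    · have he : s.1.erase v = ∅ := by
        by_contra hne
        exact h ⟨(K.isRelLowerSet_faces s.2.1).2 (Finset.erase_subset _ _)
          (Finset.nonempty_iff_ne_empty.mpr hne), by rw [simplex_erase s hv, hij]⟩
      simp only [elementaryChain, h, dite_false, LinearMap.zero_apply, map_zero]
      rw [he]
      simp
  simp only [LinearMap.comp_apply, LinearMap.zero_apply]
  rw [show simplicialBoundary R M K i j (Finsupp.single s m) =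
    ∑ v ∈ s.1, incidence s.1 v • elementaryChain R M K j (s.1.erase v) m by
      simp [simplicialBoundary]]
  rw [map_sum, ← sum_incidence_eq_zero s.1 fun t => elementaryChain R M K k t m]
  refine Finset.sum_congr rfl fun v hv => ?_
  rw [map_zsmul, key v hv, Finset.smul_sum]
  simp only [mul_smul]

lemma simplicialCoboundary_comp (i j k : ℤ) (hjk : j + 1 = k) :
    simplicialCoboundary R M K j k ∘ₗ simplicialCoboundary R M K i j = 0 := by
  ext f t
  have key : ∀ v ∈ t.1, extendCochain M K j (simplicialCoboundary R M K i j f) (t.1.erase v) =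
      ∑ w ∈ t.1.erase v, incidence (t.1.erase v) w •
        extendCochain M K i f ((t.1.erase v).erase w) := by
    intro v hv
    by_cases h : t.1.erase v ∈ K.faces ∧ ((t.1.erase v).card : ℤ) = j + 1
    · rw [extendCochain, dif_pos h]
      rfl
    · have he : t.1.erase v = ∅ := by
        by_contra hne
        exact h ⟨(K.isRelLowerSet_faces t.2.1).2 (Finset.erase_subset _ _)
          (Finset.nonempty_iff_ne_empty.mpr hne), by rw [simplex_erase t hv, hjk]⟩
      rw [extendCochain, dif_neg h, he]
      simp
  change ∑ v ∈ t.1, incidence t.1 v •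
    extendCochain M K j (simplicialCoboundary R M K i j f) (t.1.erase v) = 0
  rw [← sum_incidence_eq_zero t.1 (extendCochain M K i f)]
  refine Finset.sum_congr rfl fun v hv => ?_
  rw [key v hv, Finset.smul_sum]
  simp only [mul_smul]

/-- The simplicial chain complex `C_*(K; M)`. -/
def simplicialChains : ChainComplex (ModuleCat.{max u v} R) ℤ where
  X n := ModuleCat.of R (K.Simplex n →₀ M)
  d i j := ModuleCat.ofHom (simplicialBoundary R M K i j)
  shape i j h := by
    have : simplicialBoundary R M K i j = 0 := by
      refine Finsupp.lhom_ext fun s m => ?_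
      simp only [simplicialBoundary, Finsupp.lsum_single, LinearMap.zero_apply,
        LinearMap.sum_apply]
      refine Finset.sum_eq_zero fun v hv => ?_
      rw [elementaryChain_eq_zero]
      · simp
      · rw [simplex_erase s hv]
        exact fun h' => h h'.symm
    rw [this]
    rfl
  d_comp_d' i j k hij _ := by
    rw [← ModuleCat.ofHom_comp, simplicialBoundary_comp R M K i j k hij]
    rfl

/-- The simplicial cochain complex `C^*(K; M)`. -/
def simplicialCochains : CochainComplex (ModuleCat.{max u v} R) ℤ where
  X n := ModuleCat.of R (K.Simplex n → M)
  d i j := ModuleCat.ofHom (simplicialCoboundary R M K i j)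
  shape i j h := by
    have : simplicialCoboundary R M K i j = 0 := by
      ext f t
      refine Finset.sum_eq_zero fun v hv => ?_
      rw [extendCochain, dif_neg, smul_zero]
      rintro ⟨-, h'⟩
      rw [simplex_erase t hv] at h'
      exact h h'.symm
    rw [this]
    rfl
  d_comp_d' i j k _ hjk := by
    rw [← ModuleCat.ofHom_comp, simplicialCoboundary_comp R M K i j k hjk]
    rfl

variable {K}

/-- The increasing filtration of `C_*(K; M)` by the subcomplexes `C_*(K_p; M)`. -/
def MorseShelling.chainFiltration (S : MorseShelling K) (p n : ℤ) :
    Submodule R ((simplicialChains R M K).X n) :=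
  Finsupp.supported M R {s : K.Simplex n | s.1 ∈ (S.subcomplex p).faces}

/-- The decreasing filtration of `C^*(K; M)` by the subcomplexes `C^*(K, K_p; M)` of the cochains
vanishing on `K_p`. -/
def MorseShelling.cochainFiltration (S : MorseShelling K) (p n : ℤ) :
    Submodule R ((simplicialCochains R M K).X n) :=
  ({ carrier := {f | ∀ s : K.Simplex n, s.1 ∈ (S.subcomplex p).faces → f s = 0}
     add_mem' := fun hf hg s hs => by simp [hf s hs, hg s hs]
     zero_mem' := fun _ _ => rfl
     smul_mem' := fun c f hf s hs => by simp [hf s hs] } : Submodule R (K.Simplex n → M))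

end Chains

/-! ### The spectral sequence of a filtered complex -/

section Spectral

variable {R : Type w} [CommRing R]

/-- A homological spectral sequence has differentials of bidegree `(-r, r - 1)` on the
`r`th page. -/
abbrev HomologicalSpectralSequence (C : Type*) [Category C] [Abelian C] (r₀ : ℤ) :=
  SpectralSequence C (fun r ↦ ComplexShape.up' (⟨-r, r - 1⟩ : ℤ × ℤ)) r₀

/-- The filtration induced on the homology of a filtered complex: the classes which contain a
cycle of the given step of the filtration. -/
def homologyFiltration {c : ComplexShape ℤ} (C : HomologicalComplex (ModuleCat.{v} R) c)
    (F : ℤ → ∀ n, Submodule R (C.X n)) (p n : ℤ) : Submodule R (C.homology n) :=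
  ((F p n).comap (C.iCycles n).hom).map (C.homologyπ n).hom

namespace ChainComplex

variable (C : ChainComplex (ModuleCat.{v} R) ℤ) (F : ℤ → ∀ n, Submodule R (C.X n))

/-- `Z^r_p = {x ∈ F_p | d x ∈ F_{p-r}}`, in degree `n`. -/
def approxCycles (r p n : ℤ) : Submodule R (C.X n) :=
  F p n ⊓ (F (p - r) (n - 1)).comap (C.d n (n - 1)).hom

/-- `Z^{r-1}_{p-1} + d Z^{r-1}_{p+r-1}`, in degree `n`. -/
def approxBoundaries (r p n : ℤ) : Submodule R (C.X n) :=
  approxCycles C F (r - 1) (p - 1) n ⊔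
    (approxCycles C F (r - 1) (p + r - 1) (n + 1)).map (C.d (n + 1) n).hom

/-- The spectral sequence `E` is the one induced by the increasing filtration `F` of the chain
complex `C`: its term `E^r_{p,q}` is the quotient of `Z^r_p` by `Z^{r-1}_{p-1} + d Z^{r-1}_{p+r-1}`
in degree `p + q`, its differentials are induced by the one of `C`, and the isomorphisms between
the homology of a page and the next page are induced by the identity on representatives. -/
structure InducedBy (E : HomologicalSpectralSequence (ModuleCat.{v} R) 0) where
  /-- the quotient map onto `E^r_{p,q}` -/
  proj (r : ℤ) (hr : 0 ≤ r) (p q : ℤ) :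
    approxCycles C F r p (p + q) →ₗ[R] (E.page r hr).X (p, q)
  proj_surjective (r : ℤ) (hr : 0 ≤ r) (p q : ℤ) : Function.Surjective (proj r hr p q)
  proj_eq_zero_iff (r : ℤ) (hr : 0 ≤ r) (p q : ℤ) (x : approxCycles C F r p (p + q)) :
    proj r hr p q x = 0 ↔ (x : C.X (p + q)) ∈ approxBoundaries C F r p (p + q)
  d_proj (r : ℤ) (hr : 0 ≤ r) (p q : ℤ) (x : approxCycles C F r p (p + q))
    (y : approxCycles C F r (p - r) (p - r + (q + r - 1)))
    (hy : (y : C.X (p - r + (q + r - 1))) = (C.d (p + q) (p - r + (q + r - 1))).hom x) :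
    ((E.page r hr).d (p, q) (p - r, q + r - 1)).hom (proj r hr p q x) =
      proj r hr (p - r) (q + r - 1) y
  iso_proj (r : ℤ) (hr : 0 ≤ r) (p q : ℤ) (x : approxCycles C F r p (p + q))
    (y : approxCycles C F (r + 1) p (p + q)) (hxy : (x : C.X (p + q)) = y)
    (z : (E.page r hr).cycles (p, q))
    (hz : ((E.page r hr).iCycles (p, q)).hom z = proj r hr p q x) :
    (E.iso r (r + 1) (p, q) rfl hr).hom.hom (((E.page r hr).homologyπ (p, q)).hom z) =
      proj (r + 1) (Int.le_add_one hr) p q y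

end ChainComplex

namespace CochainComplex

variable (C : CochainComplex (ModuleCat.{v} R) ℤ) (F : ℤ → ∀ n, Submodule R (C.X n))

/-- `Z_r^p = {x ∈ F^p | d x ∈ F^{p+r}}`, in degree `n`. -/
def approxCocycles (r p n : ℤ) : Submodule R (C.X n) :=
  F p n ⊓ (F (p + r) (n + 1)).comap (C.d n (n + 1)).hom

/-- `Z_{r-1}^{p+1} + d Z_{r-1}^{p-r+1}`, in degree `n`. -/
def approxCoboundaries (r p n : ℤ) : Submodule R (C.X n) :=
  approxCocycles C F (r - 1) (p + 1) n ⊔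
    (approxCocycles C F (r - 1) (p - r + 1) (n - 1)).map (C.d (n - 1) n).hom

/-- The spectral sequence `E` is the one induced by the decreasing filtration `F` of the cochain
complex `C`: its term `E_r^{p,q}` is the quotient of `Z_r^p` by `Z_{r-1}^{p+1} + d Z_{r-1}^{p-r+1}`
in degree `p + q`, its differentials are induced by the one of `C`, and the isomorphisms between
the cohomology of a page and the next page are induced by the identity on representatives. -/
structure InducedBy (E : CohomologicalSpectralSequence (ModuleCat.{v} R) 0) where
  /-- the quotient map onto `E_r^{p,q}` -/
  proj (r : ℤ) (hr : 0 ≤ r) (p q : ℤ) :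
    approxCocycles C F r p (p + q) →ₗ[R] (E.page r hr).X (p, q)
  proj_surjective (r : ℤ) (hr : 0 ≤ r) (p q : ℤ) : Function.Surjective (proj r hr p q)
  proj_eq_zero_iff (r : ℤ) (hr : 0 ≤ r) (p q : ℤ) (x : approxCocycles C F r p (p + q)) :
    proj r hr p q x = 0 ↔ (x : C.X (p + q)) ∈ approxCoboundaries C F r p (p + q)
  d_proj (r : ℤ) (hr : 0 ≤ r) (p q : ℤ) (x : approxCocycles C F r p (p + q))
    (y : approxCocycles C F r (p + r) (p + r + (q + 1 - r)))
    (hy : (y : C.X (p + r + (q + 1 - r))) = (C.d (p + q) (p + r + (q + 1 - r))).hom x) :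
    ((E.page r hr).d (p, q) (p + r, q + 1 - r)).hom (proj r hr p q x) =
      proj r hr (p + r) (q + 1 - r) y
  iso_proj (r : ℤ) (hr : 0 ≤ r) (p q : ℤ) (x : approxCocycles C F r p (p + q))
    (y : approxCocycles C F (r + 1) p (p + q)) (hxy : (x : C.X (p + q)) = y)
    (z : (E.page r hr).cycles (p, q))
    (hz : ((E.page r hr).iCycles (p, q)).hom z = proj r hr p q x) :
    (E.iso r (r + 1) (p, q) rfl hr).hom.hom (((E.page r hr).homologyπ (p, q)).hom z) =
      proj (r + 1) (Int.le_add_one hr) p q y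

end CochainComplex

/-- The homological spectral sequence `E` degenerates at the page `N` and converges to the graded
module `H`, endowed with the finite increasing filtration `Φ`: the differentials vanish from the
page `N` on, and `E^r_{p,q}` is isomorphic to `Φ_p H_{p+q} / Φ_{p-1} H_{p+q}` for every
`r ≥ N`. -/
structure HomologicalConvergence (E : HomologicalSpectralSequence (ModuleCat.{v} R) 0) (N : ℕ)
    (H : ℤ → ModuleCat.{v} R) (Φ : ℤ → ∀ n, Submodule R (H n)) : Prop where
  monotone : ∀ n p, Φ p n ≤ Φ (p + 1) n
  eq_bot : ∀ n, ∃ p, Φ p n = ⊥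
  eq_top : ∀ n, ∃ p, Φ p n = ⊤
  d_eq_zero : ∀ (r : ℤ) (hr : 0 ≤ r), N ≤ r → ∀ a b, (E.page r hr).d a b = 0
  limit : ∀ (r : ℤ) (hr : 0 ≤ r), N ≤ r → ∀ p q : ℤ,
    Nonempty ((E.page r hr).X (p, q) ≃ₗ[R]
      Φ p (p + q) ⧸ (Φ (p - 1) (p + q)).submoduleOf (Φ p (p + q)))

/-- The cohomological spectral sequence `E` degenerates at the page `N` and converges to the graded
module `H`, endowed with the finite decreasing filtration `Φ`: the differentials vanish from the
page `N` on, and `E_r^{p,q}` is isomorphic to `Φ^p H^{p+q} / Φ^{p+1} H^{p+q}` for every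
`r ≥ N`. -/
structure CohomologicalConvergence (E : CohomologicalSpectralSequence (ModuleCat.{v} R) 0) (N : ℕ)
    (H : ℤ → ModuleCat.{v} R) (Φ : ℤ → ∀ n, Submodule R (H n)) : Prop where
  antitone : ∀ n p, Φ (p + 1) n ≤ Φ p n
  eq_top : ∀ n, ∃ p, Φ p n = ⊤
  eq_bot : ∀ n, ∃ p, Φ p n = ⊥
  d_eq_zero : ∀ (r : ℤ) (hr : 0 ≤ r), N ≤ r → ∀ a b, (E.page r hr).d a b = 0
  limit : ∀ (r : ℤ) (hr : 0 ≤ r), N ≤ r → ∀ p q : ℤ,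
    Nonempty ((E.page r hr).X (p, q) ≃ₗ[R]
      Φ p (p + q) ⧸ (Φ (p + 1) (p + q)).submoduleOf (Φ p (p + q)))

end Spectral

end

/-! From the geometry only the combinatorics of simplices survives. An open simplex either lies in a
tile or misses it (`MorseTile.mem_carrier_iff`), so the tiling partitions the simplices of `K` into
the sets `MorseTile.faces`. The unions of the first tiles are closed, hence contain a closed simplex
as soon as they contain its interior. Thus `K_p` consists of the simplices of the first `p` tiles
(`MorseShelling.mem_subcomplex_iff`), and each nontrivial graded piece of either filtration lives on
the simplices of a single tile.

Such a piece is computed by a discrete Morse argument with one vertex `v`. Adding and deleting `v`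
pairs off the simplices of the tile with at most one left over, and the tile is critical of index
`k` exactly when a simplex of dimension `k` is left over (`MorseTile.exists_matching`). The cone
homotopy of `v`, cut down to the tile, contracts the piece onto that simplex (`faceMatrix_homotopy`,
`unmatchedRestriction_mul_faceMatrix`, `faceMatrix_mul_unmatchedCocycle`). All maps involved are
integer matrices, so one set of identities serves every coefficient module, and transposition turns
the cochain statement into the chain statement.

The remainder is the theory of filtered complexes, developed once for a differential of degree `ε`
and applied with `ε = -1` and `ε = 1`. Pages are explicit subquotients; `exists_homology_iso` passes
from one page to the next, `Contraction.mem_relBoundaries_one` reads the first page off a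
contraction, and `page_limit` identifies the late pages: once `r ≥ N`, moving `r` steps from a
nontrivial piece leaves the range of the filtration, so approximate cycles are cycles and no
boundary is missed. -/

noncomputable section

/-! ### Elementwise homology of complexes of modules -/

/-- Two surjective linear maps with the same kernel have isomorphic targets. -/
lemma LinearMap.exists_equiv_of_ker_eq {R A B D : Type*} [Ring R] [AddCommGroup A] [Module R A]
    [AddCommGroup B] [Module R B] [AddCommGroup D] [Module R D] (f : A →ₗ[R] B) (g : A →ₗ[R] D)
    (hf : Function.Surjective f) (hg : Function.Surjective g) (h : ∀ x, f x = 0 ↔ g x = 0) :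
    ∃ e : B ≃ₗ[R] D, ∀ x, e (f x) = g x := by
  have hk : LinearMap.ker f = LinearMap.ker g := by ext x; exact h x
  refine ⟨(f.quotKerEquivOfSurjective hf).symm ≪≫ₗ Submodule.quotEquivOfEq _ _ hk ≪≫ₗ
    g.quotKerEquivOfSurjective hg, fun x => ?_⟩
  have : (f.quotKerEquivOfSurjective hf).symm (f x) = Submodule.Quotient.mk x := by
    rw [LinearEquiv.symm_apply_eq]; rfl
  simp only [LinearEquiv.trans_apply, this]
  rfl

namespace HomologicalComplex

variable {R : Type w} [CommRing R] {ι : Type*} {c : ComplexShape ι}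
  (P : HomologicalComplex (ModuleCat.{v} R) c)

lemma moduleCat_d_d_apply (i j k : ι) (x : P.X i) : (P.d j k).hom ((P.d i j).hom x) = 0 := by
  rw [← LinearMap.comp_apply, ← ModuleCat.hom_comp, P.d_comp_d]
  rfl

lemma moduleCat_d_eq_zero {i j : ι} (h : ¬ c.Rel i j) (x : P.X i) : (P.d i j).hom x = 0 := by
  rw [P.shape i j h]
  rfl

lemma moduleCat_d_iCycles (i j : ι) (z : P.cycles i) :
    (P.d i j).hom ((P.iCycles i).hom z) = 0 := by
  rw [← LinearMap.comp_apply, ← ModuleCat.hom_comp, P.iCycles_d]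
  rfl

lemma moduleCat_iCycles_injective (i : ι) : Function.Injective (P.iCycles i).hom :=
  (ModuleCat.mono_iff_injective (P.iCycles i)).mp inferInstance

lemma moduleCat_homologyπ_surjective (i : ι) : Function.Surjective (P.homologyπ i).hom :=
  (ModuleCat.epi_iff_surjective (P.homologyπ i)).mp inferInstance

lemma moduleCat_exists_cycle (i : ι) (x : P.X i) (hx : ∀ j, (P.d i j).hom x = 0) :
    ∃ z : P.cycles i, (P.iCycles i).hom z = x := by
  let y : (P.sc i).moduleCatLeftHomologyData.K := ⟨x, hx _⟩
  refine ⟨(P.sc i).moduleCatCyclesIso.inv.hom y, ?_⟩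
  exact (P.sc i).moduleCatCyclesIso_inv_iCycles_apply y

/-- Homology is the cokernel of the map from the previous term to the cycles. Leaving the source
degree `j` free keeps `c.prev` out of later arguments. -/
lemma moduleCat_homologyπ_eq_zero_iff (i : ι) (z : P.cycles i) :
    (P.homologyπ i).hom z = 0 ↔ ∃ j, ∃ y : P.X j, (P.d j i).hom y = (P.iCycles i).hom z := by
  have hex : (ShortComplex.mk (P.toCycles (c.prev i) i) (P.homologyπ i)
      (P.toCycles_comp_homologyπ _ _)).Exact :=
    ShortComplex.exact_of_g_is_cokernel _ (P.homologyIsCokernel (c.prev i) i rfl)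
  rw [ShortComplex.moduleCat_exact_iff] at hex
  constructor
  · intro h
    obtain ⟨y, hy⟩ := hex z h
    refine ⟨_, y, ?_⟩
    rw [← P.toCycles_i (c.prev i) i]
    exact congrArg _ hy
  · rintro ⟨j, y, hy⟩
    have hz : z = (P.toCycles j i).hom y := by
      apply P.moduleCat_iCycles_injective
      rw [← hy, ← P.toCycles_i j i]
      rfl
    rw [hz, ← LinearMap.comp_apply, ← ModuleCat.hom_comp, P.toCycles_comp_homologyπ]
    rfl

/-- The homology of `P` at `i` is the target `Q` of a surjection `g` when all cycles are
represented through a map `f` and `g` vanishes precisely on what `f` maps to boundaries. -/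
lemma moduleCat_exists_homology_iso (i : ι) {A : Type*} [AddCommGroup A] [Module R A]
    {Q : ModuleCat.{v} R} (f : A →ₗ[R] P.X i) (g : A →ₗ[R] Q) (hg : Function.Surjective g)
    (hf : ∀ x j, (P.d i j).hom (f x) = 0)
    (hf' : ∀ y, (∀ j, (P.d i j).hom y = 0) → ∃ x, f x = y)
    (h : ∀ x, g x = 0 ↔ ∃ j, ∃ y : P.X j, (P.d j i).hom y = f x) :
    ∃ e : P.homology i ≅ Q, ∀ (x : A) (z : P.cycles i), (P.iCycles i).hom z = f x →
      e.hom.hom ((P.homologyπ i).hom z) = g x := by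
  -- The chosen lifts to cycles are automatically linear because cycles embed in `P.X i`.
  choose s hs using fun x => P.moduleCat_exists_cycle i (f x) (hf x)
  have inj := P.moduleCat_iCycles_injective i
  let s' : A →ₗ[R] P.cycles i :=
    { toFun := s
      map_add' x y := inj (by simp [hs])
      map_smul' a x := inj (by simp [hs]) }
  obtain ⟨e, he⟩ := LinearMap.exists_equiv_of_ker_eq ((P.homologyπ i).hom ∘ₗ s') g (fun y => by
      obtain ⟨z, rfl⟩ := P.moduleCat_homologyπ_surjective i y
      obtain ⟨x, hx⟩ := hf' _ (fun j => P.moduleCat_d_iCycles i j z)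
      refine ⟨x, congrArg (P.homologyπ i).hom (inj ?_)⟩
      rw [← hx]
      exact hs x) hg (fun x => by
      rw [h, ← hs x]
      exact P.moduleCat_homologyπ_eq_zero_iff i (s x))
  refine ⟨e.toModuleIso, fun x z hz => ?_⟩
  rw [← he x]
  have : z = s x := inj (hz.trans (hs x).symm)
  rw [this]
  rfl

end HomologicalComplex

/-! ### The spectral sequence of a filtered complex -/

namespace FilteredComplex

variable {R : Type w} [CommRing R] {c : ComplexShape ℤ}
  (C : HomologicalComplex (ModuleCat.{v} R) c) (F : ℤ → ∀ n, Submodule R (C.X n))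

/-- The elements of `F_p` whose differentials are in `F_{p'}`, in degree `n`. -/
def relCycles (p p' n : ℤ) : Submodule R (C.X n) :=
  F p n ⊓ ⨅ m, (F p' m).comap (C.d n m).hom

variable {C F} in
lemma mem_relCycles {p p' n : ℤ} {x : C.X n} :
    x ∈ relCycles C F p p' n ↔ x ∈ F p n ∧ ∀ m, (C.d n m).hom x ∈ F p' m := by
  simp [relCycles]

variable (ε : ℤ)

/-- The denominator of the `r`th page of the spectral sequence of a filtered complex, the
differential being of degree `ε` and the filtration decreasing in the direction of `ε`. -/
def relBoundaries (r p n : ℤ) : Submodule R (C.X n) :=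
  relCycles C F (p + ε) (p + ε * r) n ⊔
    (relCycles C F (p - ε * (r - 1)) p (n - ε)).map (C.d (n - ε) n).hom

-- Differentials into degree `n` from degrees other than `n - ε` vanish, so the source degree can be
-- left free. Like the quantifier over all target degrees in `relCycles`, this avoids transporting
-- elements along equalities of degrees.
variable {C F ε} in
lemma mem_relBoundaries (hc : ∀ i j, c.Rel i j ↔ i + ε = j) {r p n : ℤ} {x : C.X n} :
    x ∈ relBoundaries C F ε r p n ↔ ∃ a ∈ relCycles C F (p + ε) (p + ε * r) n, ∃ m,
      ∃ b ∈ relCycles C F (p - ε * (r - 1)) p m, a + (C.d m n).hom b = x := by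
  simp only [relBoundaries, Submodule.mem_sup, Submodule.mem_map]
  constructor
  · rintro ⟨a, ha, _, ⟨b, hb, rfl⟩, h⟩
    exact ⟨a, ha, _, b, hb, h⟩
  · rintro ⟨a, ha, m, b, hb, h⟩
    by_cases hm : m = n - ε
    · subst hm
      exact ⟨a, ha, _, ⟨b, hb, rfl⟩, h⟩
    · refine ⟨a, ha, 0, ⟨0, zero_mem _, map_zero _⟩, ?_⟩
      rw [← h, C.moduleCat_d_eq_zero fun hr => hm (by linarith [(hc _ _).mp hr])]

/-- The numerator of the term `E_r^a`. -/
abbrev pageCycles (r : ℤ) (a : ℤ × ℤ) : Submodule R (C.X (a.1 + a.2)) :=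
  relCycles C F a.1 (a.1 + ε * r) (a.1 + a.2)

/-- The term `E_r^a` of the spectral sequence of a filtered complex. -/
abbrev PageX (r : ℤ) (a : ℤ × ℤ) : Type v :=
  pageCycles C F ε r a ⧸
    (relBoundaries C F ε r a.1 (a.1 + a.2)).submoduleOf (pageCycles C F ε r a)

/-- The quotient map onto the term `E_r^a`. -/
abbrev pageMk (r : ℤ) (a : ℤ × ℤ) : pageCycles C F ε r a →ₗ[R] PageX C F ε r a :=
  Submodule.mkQ _

variable {C F ε}

lemma pageMk_surjective (r : ℤ) (a : ℤ × ℤ) : Function.Surjective (pageMk C F ε r a) :=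
  Submodule.mkQ_surjective _

lemma pageMk_eq_zero_iff {r : ℤ} {a : ℤ × ℤ} (x : pageCycles C F ε r a) :
    pageMk C F ε r a x = 0 ↔ (x : C.X (a.1 + a.2)) ∈ relBoundaries C F ε r a.1 (a.1 + a.2) := by
  rw [Submodule.mkQ_apply, Submodule.Quotient.mk_eq_zero]
  rfl

/-- The second bound `q` is arbitrary since the differential squares to zero. -/
lemma d_mem_relCycles {p p' q n m : ℤ} {x : C.X n} (hx : x ∈ relCycles C F p p' n) :
    (C.d n m).hom x ∈ relCycles C F p' q m :=
  mem_relCycles.mpr ⟨(mem_relCycles.mp hx).2 m, fun k => by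
    rw [C.moduleCat_d_d_apply]
    exact zero_mem _⟩

lemma relCycles_mono {p p' q q' n : ℤ} (h : F p n ≤ F q n) (h' : ∀ m, F p' m ≤ F q' m) :
    relCycles C F p p' n ≤ relCycles C F q q' n := fun _ hx =>
  mem_relCycles.mpr ⟨h (mem_relCycles.mp hx).1, fun m => h' m ((mem_relCycles.mp hx).2 m)⟩

/-- Of `x = a + d b` only `d a` survives, and `a` is an admissible primitive for the denominator at
`p'` because `p' - ε * (r - 1) = p + ε`. -/
lemma d_mem_relBoundaries (hc : ∀ i j, c.Rel i j ↔ i + ε = j) {r p p' n m : ℤ}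
    (h : p + ε * r = p') {x : C.X n} (hx : x ∈ relBoundaries C F ε r p n) :
    (C.d n m).hom x ∈ relBoundaries C F ε r p' m := by
  obtain ⟨a, ha, k, b, -, rfl⟩ := (mem_relBoundaries hc).mp hx
  refine (mem_relBoundaries hc).mpr ⟨0, zero_mem _, n, a, ?_, ?_⟩
  · rw [← h, show p + ε * r - ε * (r - 1) = p + ε by ring]
    exact ha
  · rw [map_add, C.moduleCat_d_d_apply, zero_add, add_zero]

variable (C F ε) in
/-- The differential of a page of the spectral sequence of a filtered complex. -/
def pageD (hc : ∀ i j, c.Rel i j ↔ i + ε = j) (r : ℤ) (a b : ℤ × ℤ) (h : a.1 + ε * r = b.1) :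
    PageX C F ε r a →ₗ[R] PageX C F ε r b :=
  Submodule.mapQ _ _
    ((C.d (a.1 + a.2) (b.1 + b.2)).hom.restrict (p := pageCycles C F ε r a)
      (q := pageCycles C F ε r b) fun x hx => d_mem_relCycles (by rwa [← h]))
    fun _ hx => d_mem_relBoundaries hc h hx

lemma pageD_mk (hc : ∀ i j, c.Rel i j ↔ i + ε = j) (r : ℤ) (a b : ℤ × ℤ) (h : a.1 + ε * r = b.1)
    (x : pageCycles C F ε r a) (y : pageCycles C F ε r b)
    (hy : (y : C.X (b.1 + b.2)) = (C.d (a.1 + a.2) (b.1 + b.2)).hom x) :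
    pageD C F ε hc r a b h (pageMk C F ε r a x) = pageMk C F ε r b y := by
  have : y = (C.d (a.1 + a.2) (b.1 + b.2)).hom.restrict (p := pageCycles C F ε r a)
      (q := pageCycles C F ε r b) (fun x hx => d_mem_relCycles (by rwa [← h])) x :=
    Subtype.ext hy
  rw [this]
  rfl

variable (cc : ℤ → ComplexShape (ℤ × ℤ))

variable (C F ε) in
open Classical in
/-- The `r`th page of the spectral sequence of a filtered complex. -/
def page (hc : ∀ i j, c.Rel i j ↔ i + ε = j)
    (hcc : ∀ r a b, (cc r).Rel a b ↔ a.1 + ε * r = b.1 ∧ a.2 + ε * (1 - r) = b.2) (r : ℤ) :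
    HomologicalComplex (ModuleCat.{v} R) (cc r) where
  X a := ModuleCat.of R (PageX C F ε r a)
  d a b := if h : (cc r).Rel a b then
    ModuleCat.ofHom (pageD C F ε hc r a b ((hcc r a b).mp h).1) else 0
  shape a b h := dif_neg h
  d_comp_d' a b e hab hbe := by
    rw [dif_pos hab, dif_pos hbe, ← ModuleCat.ofHom_comp]
    ext x
    have h1 := ((hcc r a b).mp hab).1
    have h2 := ((hcc r b e).mp hbe).1
    change pageD C F ε hc r b e h2 (pageD C F ε hc r a b h1 (pageMk C F ε r a x)) = 0
    rw [pageD_mk hc r a b h1 x ⟨_, d_mem_relCycles (by rw [← h1]; exact x.2)⟩ rfl,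
      pageD_mk hc r b e h2 _ 0 (C.moduleCat_d_d_apply _ _ _ _).symm, map_zero]

section

variable (hF : ∀ p n, F (p + ε) n ≤ F p n)
include hF


lemma relCycles_succ_le (r p n : ℤ) :
    relCycles C F p (p + ε * (r + 1)) n ≤ relCycles C F p (p + ε * r) n :=
  relCycles_mono le_rfl fun m => by
    rw [show p + ε * (r + 1) = p + ε * r + ε by ring]
    exact hF _ _

/-- Elements whose differential is a boundary for the `r`th page may be corrected by such a
boundary so that their differential is one step further in the filtration. -/
lemma exists_sub_mem_relBoundaries (hc : ∀ i j, c.Rel i j ↔ i + ε = j) {r p p' n m : ℤ}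
    (h : p + ε * r = p') (hnm : c.Rel n m) {x : C.X n}
    (hx : x ∈ relCycles C F p p' n) (hdx : (C.d n m).hom x ∈ relBoundaries C F ε r p' m) :
    ∃ y ∈ relCycles C F p (p + ε * (r + 1)) n, x - y ∈ relBoundaries C F ε r p n := by
  subst h
  obtain ⟨a, ha, k, b, hb, hab⟩ := (mem_relBoundaries hc).mp hdx
  by_cases hk : c.Rel k m
  · obtain rfl : k = n := c.prev_eq hk hnm
    have hb' : b ∈ relCycles C F (p + ε) (p + ε * r) k := by
      rwa [show p + ε * r - ε * (r - 1) = p + ε by ring] at hb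
    refine ⟨x - b, mem_relCycles.mpr ⟨sub_mem (mem_relCycles.mp hx).1
      (hF _ _ (mem_relCycles.mp hb').1), fun j => ?_⟩, ?_⟩
    · by_cases hj : c.Rel k j
      · obtain rfl : m = j := c.next_eq hnm hj
        rw [map_sub, ← hab, add_sub_cancel_right, show p + ε * (r + 1) = p + ε * r + ε by ring]
        exact (mem_relCycles.mp ha).1
      · rw [C.moduleCat_d_eq_zero hj]
        exact zero_mem _
    · rw [sub_sub_cancel]
      exact (mem_relBoundaries hc).mpr ⟨b, hb', k, 0, zero_mem _, by simp⟩
  · rw [C.moduleCat_d_eq_zero hk, add_zero] at hab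
    refine ⟨x, mem_relCycles.mpr ⟨(mem_relCycles.mp hx).1, fun j => ?_⟩, by simp⟩
    by_cases hj : c.Rel n j
    · obtain rfl : m = j := c.next_eq hnm hj
      rw [← hab, show p + ε * (r + 1) = p + ε * r + ε by ring]
      exact (mem_relCycles.mp ha).1
    · rw [C.moduleCat_d_eq_zero hj]
      exact zero_mem _

lemma mem_relBoundaries_succ_iff (hc : ∀ i j, c.Rel i j ↔ i + ε = j) {r p n : ℤ} {x : C.X n}
    (hx : x ∈ relCycles C F p (p + ε * (r + 1)) n) :
    x ∈ relBoundaries C F ε (r + 1) p n ↔ ∃ m, ∃ y ∈ relCycles C F (p - ε * r) p m,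
      x - (C.d m n).hom y ∈ relBoundaries C F ε r p n := by
  constructor
  · intro h
    obtain ⟨a, ha, m, b, hb, rfl⟩ := (mem_relBoundaries hc).mp h
    rw [add_sub_cancel_right] at hb
    refine ⟨m, b, hb, ?_⟩
    rw [add_sub_cancel_right]
    exact (mem_relBoundaries hc).mpr ⟨a, relCycles_mono le_rfl (fun k => by
      rw [show p + ε * (r + 1) = p + ε * r + ε by ring]
      exact hF _ _) ha, m, 0, zero_mem _, by simp⟩
  · rintro ⟨m, y, hy, h⟩
    obtain ⟨a, ha, k, b, hb, hab⟩ := (mem_relBoundaries hc).mp h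
    -- A primitive admissible for page `r` is also admissible for page `r + 1`, so `b` and `y` can
    -- be treated alike.
    have hb' : b ∈ relCycles C F (p - ε * r) p k := relCycles_mono (by
      rw [show p - ε * (r - 1) = p - ε * r + ε by ring]
      exact hF _ _) (fun _ => le_rfl) hb
    have hxe : x = a + ((C.d k n).hom b + (C.d m n).hom y) := by
      rw [← add_assoc, hab, sub_add_cancel]
    -- The other summands of `x` are boundaries, so `a` has the differential of `x` and inherits its
    -- stronger bound.
    refine Submodule.mem_sup.mpr ⟨a, mem_relCycles.mpr ⟨(mem_relCycles.mp ha).1, fun j => ?_⟩,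
      _, ?_, hxe.symm⟩
    · have := (mem_relCycles.mp hx).2 j
      rwa [hxe, map_add, map_add, C.moduleCat_d_d_apply, C.moduleCat_d_d_apply, add_zero,
        add_zero] at this
    · have key : ∀ m' (b' : C.X m'), b' ∈ relCycles C F (p - ε * r) p m' →
          (C.d m' n).hom b' ∈
            (relCycles C F (p - ε * (r + 1 - 1)) p (n - ε)).map (C.d (n - ε) n).hom := by
        intro m' b' hb'
        by_cases hm : m' = n - ε
        · subst hm
          rw [add_sub_cancel_right]
          exact ⟨b', hb', rfl⟩
        · rw [C.moduleCat_d_eq_zero fun hr => hm (by linarith [(hc _ _).mp hr])]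
          exact zero_mem _
      exact add_mem (key _ _ hb') (key _ _ hy)

/-- The homology of a complex whose terms and differentials are those of the `r`th page of the
spectral sequence of a filtered complex is given by the terms of the next page. -/
lemma exists_homology_iso (hc : ∀ i j, c.Rel i j ↔ i + ε = j) {r : ℤ}
    {cr : ComplexShape (ℤ × ℤ)}
    (hcr : ∀ a b, cr.Rel a b ↔ a.1 + ε * r = b.1 ∧ a.2 + ε * (1 - r) = b.2)
    (P : HomologicalComplex (ModuleCat.{v} R) cr) (π : ∀ a, pageCycles C F ε r a →ₗ[R] P.X a)
    (hπ : ∀ a, Function.Surjective (π a))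
    (hπ0 : ∀ a (x : pageCycles C F ε r a), π a x = 0 ↔
      (x : C.X (a.1 + a.2)) ∈ relBoundaries C F ε r a.1 (a.1 + a.2))
    (hd : ∀ a b, cr.Rel a b → ∀ (x : pageCycles C F ε r a) (y : pageCycles C F ε r b),
      (y : C.X (b.1 + b.2)) = (C.d (a.1 + a.2) (b.1 + b.2)).hom x →
        (P.d a b).hom (π a x) = π b y)
    (a : ℤ × ℤ) {Q : ModuleCat.{v} R} (π' : pageCycles C F ε (r + 1) a →ₗ[R] Q)
    (hπ' : Function.Surjective π')
    (hπ'0 : ∀ x : pageCycles C F ε (r + 1) a, π' x = 0 ↔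
      (x : C.X (a.1 + a.2)) ∈ relBoundaries C F ε (r + 1) a.1 (a.1 + a.2)) :
    ∃ e : P.homology a ≅ Q,
      ∀ (x : pageCycles C F ε r a) (y : pageCycles C F ε (r + 1) a)
        (_ : (x : C.X (a.1 + a.2)) = y) (z : P.cycles a) (_ : (P.iCycles a).hom z = π a x),
        e.hom.hom ((P.homologyπ a).hom z) = π' y := by
  have hπe : ∀ a (x y : pageCycles C F ε r a), π a x = π a y ↔
      (x - y : C.X (a.1 + a.2)) ∈ relBoundaries C F ε r a.1 (a.1 + a.2) := by
    intro a x y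
    rw [← sub_eq_zero, ← map_sub, hπ0]
    rfl
  have hle := relCycles_succ_le hF r a.1 (a.1 + a.2)
  refine Exists.imp ?_ (P.moduleCat_exists_homology_iso a
    (π a ∘ₗ Submodule.inclusion hle) π' hπ' ?_ ?_ ?_)
  · refine fun e he x y hxy z hz => he y z ?_
    rw [hz, LinearMap.comp_apply, show x = Submodule.inclusion hle y from
      Subtype.ext (hxy.trans (Submodule.coe_inclusion hle y).symm)]
  -- The differential of an element of the next numerator falls in the first summand of the
  -- denominator of the target.
  · rintro ⟨x, hx⟩ b
    rw [LinearMap.comp_apply]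
    by_cases hb : cr.Rel a b
    · have h1 := ((hcr a b).mp hb).1
      have hx : (C.d (a.1 + a.2) (b.1 + b.2)).hom x ∈
          relCycles C F (b.1 + ε) (b.1 + ε * r) (b.1 + b.2) := d_mem_relCycles (by
        rwa [show b.1 + ε = a.1 + ε * (r + 1) by rw [← h1]; ring])
      rw [hd a b hb _ ⟨_, relCycles_mono (hF _ _) (fun _ => le_rfl) hx⟩ rfl,
        hπ0]
      exact (mem_relBoundaries hc).mpr ⟨_, hx, b.1 + b.2, 0, zero_mem _, by simp⟩
    · exact HomologicalComplex.moduleCat_d_eq_zero _ hb _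
  -- A cycle of the page has a representative whose differential lies in the denominator; the
  -- correction moves it into the next numerator without changing its class.
  · intro y hy
    obtain ⟨x, rfl⟩ := hπ a y
    obtain ⟨b, hb1, hb2⟩ : ∃ b : ℤ × ℤ, b.1 = a.1 + ε * r ∧ b.2 = a.2 + ε * (1 - r) :=
      ⟨(_, _), rfl, rfl⟩
    have hb : cr.Rel a b := (hcr a b).mpr ⟨hb1.symm, hb2.symm⟩
    have h := hy b
    rw [hd a b hb x ⟨_, d_mem_relCycles (by rw [hb1]; exact x.2)⟩ rfl,
      hπ0] at h
    obtain ⟨y, hy, hxy⟩ := exists_sub_mem_relBoundaries hF hc hb1.symm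
      ((hc _ _).mpr (by rw [hb1, hb2]; ring)) (by rw [hb1]; exact x.2) h
    refine ⟨⟨y, hy⟩, ?_⟩
    rw [LinearMap.comp_apply, eq_comm, hπe]
    exact hxy
  -- Dying on page `r + 1` means agreeing with some `d y` modulo the denominator of page `r`; the
  -- class of `y` is then the primitive on page `r`, and conversely.
  · rintro ⟨x, hx⟩
    rw [hπ'0, mem_relBoundaries_succ_iff hF hc hx]
    simp only [LinearMap.comp_apply]
    constructor
    · rintro ⟨m, y, hy, h⟩
      by_cases hm : c.Rel m (a.1 + a.2)
      · obtain ⟨b, hb1, hb2⟩ : ∃ b : ℤ × ℤ, b.1 = a.1 - ε * r ∧ b.2 = a.2 - ε * (1 - r) :=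
          ⟨(_, _), rfl, rfl⟩
        have hba : b.1 + ε * r = a.1 := by rw [hb1]; ring
        have hb : cr.Rel b a := (hcr b a).mpr ⟨hba, by rw [hb2]; ring⟩
        have hy' : y ∈ relCycles C F b.1 (b.1 + ε * r) m := by rwa [hba, hb1]
        obtain rfl : m = b.1 + b.2 := by
          have := (hc _ _).mp hm
          rw [hb1, hb2]
          linear_combination this
        refine ⟨b, π b ⟨y, hy'⟩, ?_⟩
        rw [hd b a hb ⟨y, hy'⟩ ⟨_, d_mem_relCycles hy⟩ rfl, eq_comm, hπe]
        exact h
      · rw [C.moduleCat_d_eq_zero hm, sub_zero] at h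
        refine ⟨a, 0, ?_⟩
        rw [map_zero, eq_comm, hπ0]
        exact h
    · rintro ⟨b, y, hy⟩
      by_cases hb : cr.Rel b a
      · obtain ⟨⟨y, hy'⟩, rfl⟩ := hπ b y
        have h1 := ((hcr b a).mp hb).1
        have hy'' : y ∈ relCycles C F b.1 a.1 (b.1 + b.2) := by rwa [← h1]
        refine ⟨_, y, by rwa [show a.1 - ε * r = b.1 by rw [← h1]; ring], ?_⟩
        rw [hd b a hb ⟨y, hy'⟩ ⟨_, d_mem_relCycles hy''⟩ rfl, eq_comm,
          hπe] at hy
        exact hy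
      · rw [HomologicalComplex.moduleCat_d_eq_zero _ hb, eq_comm, hπ0] at hy
        exact ⟨0, 0, zero_mem _, by simpa using hy⟩

end

variable {cc} (hc : ∀ i j, c.Rel i j ↔ i + ε = j)
  (hcc : ∀ r a b, (cc r).Rel a b ↔ a.1 + ε * r = b.1 ∧ a.2 + ε * (1 - r) = b.2)

variable (C F) in
/-- The quotient map onto a term of a page of the spectral sequence of a filtered complex. -/
def pageπ (r : ℤ) (a : ℤ × ℤ) : pageCycles C F ε r a →ₗ[R] (page C F ε cc hc hcc r).X a :=
  pageMk C F ε r a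

lemma pageπ_surjective (r : ℤ) (a : ℤ × ℤ) : Function.Surjective (pageπ C F hc hcc r a) :=
  pageMk_surjective r a

lemma pageπ_eq_zero_iff {r : ℤ} {a : ℤ × ℤ} (x : pageCycles C F ε r a) :
    pageπ C F hc hcc r a x = 0 ↔
      (x : C.X (a.1 + a.2)) ∈ relBoundaries C F ε r a.1 (a.1 + a.2) :=
  pageMk_eq_zero_iff x

lemma page_d_π (r : ℤ) {a b : ℤ × ℤ} (h : (cc r).Rel a b)
    (x : pageCycles C F ε r a) (y : pageCycles C F ε r b)
    (hy : (y : C.X (b.1 + b.2)) = (C.d (a.1 + a.2) (b.1 + b.2)).hom x) :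
    ((page C F ε cc hc hcc r).d a b).hom (pageπ C F hc hcc r a x) = pageπ C F hc hcc r b y := by
  refine Eq.trans ?_ (pageD_mk hc r a b ((hcc r a b).mp h).1 x y hy)
  simp only [page, dif_pos h]
  rfl

variable (hF : ∀ p n, F (p + ε) n ≤ F p n)

include hF in
lemma exists_page_iso (r r' : ℤ) (hr : r + 1 = r') (a : ℤ × ℤ) :
    ∃ e : (page C F ε cc hc hcc r).homology a ≅ (page C F ε cc hc hcc r').X a,
      ∀ (x : pageCycles C F ε r a) (y : pageCycles C F ε r' a)
        (_ : (x : C.X (a.1 + a.2)) = y) (z : (page C F ε cc hc hcc r).cycles a)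
        (_ : ((page C F ε cc hc hcc r).iCycles a).hom z = pageπ C F hc hcc r a x),
        e.hom.hom (((page C F ε cc hc hcc r).homologyπ a).hom z) = pageπ C F hc hcc r' a y := by
  subst hr
  exact exists_homology_iso hF hc (hcc r) _ (pageπ C F hc hcc r)
    (pageπ_surjective hc hcc r) (fun a => pageπ_eq_zero_iff hc hcc)
    (fun a b => page_d_π hc hcc r) a
    (pageπ C F hc hcc (r + 1) a) (pageπ_surjective hc hcc _ _) (pageπ_eq_zero_iff hc hcc)

variable (cc) in
/-- The spectral sequence of a filtered complex. -/
def spectralSequence : SpectralSequence (ModuleCat.{v} R) cc 0 where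
  page r _ := page C F ε cc hc hcc r
  iso r r' a hr _ := (exists_page_iso hc hcc hF r r' hr a).choose

/-- The isomorphism is a choice, but this property determines it, since every homology class of a
page is represented in the next numerator. -/
lemma spectralSequence_iso_apply (r r' : ℤ) (h0 : 0 ≤ r) (hr : r + 1 = r') (a : ℤ × ℤ)
    (x : pageCycles C F ε r a) (y : pageCycles C F ε r' a)
    (hxy : (x : C.X (a.1 + a.2)) = y) (z : (page C F ε cc hc hcc r).cycles a)
    (hz : ((page C F ε cc hc hcc r).iCycles a).hom z = pageπ C F hc hcc r a x) :
    ((spectralSequence cc hc hcc hF).iso r r' a hr h0).hom.hom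
      (((page C F ε cc hc hcc r).homologyπ a).hom z) = pageπ C F hc hcc r' a y :=
  (exists_page_iso hc hcc hF r r' hr a).choose_spec x y hxy z hz

end FilteredComplex

/-! ### The filtration induced on homology -/

section HomologyFiltration

variable {R : Type w} [CommRing R] {c : ComplexShape ℤ}
  (C : HomologicalComplex (ModuleCat.{v} R) c) (F : ℤ → ∀ n, Submodule R (C.X n))

variable {C F} in
lemma mem_homologyFiltration {p n : ℤ} {y : C.homology n} :
    y ∈ homologyFiltration C F p n ↔
      ∃ z : C.cycles n, (C.iCycles n).hom z ∈ F p n ∧ (C.homologyπ n).hom z = y :=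
  Iff.rfl

lemma homologyFiltration_mono {p q n : ℤ} (h : F p n ≤ F q n) :
    homologyFiltration C F p n ≤ homologyFiltration C F q n :=
  Submodule.map_mono (Submodule.comap_mono h)

lemma homologyFiltration_eq_bot {p n : ℤ} (h : F p n = ⊥) : homologyFiltration C F p n = ⊥ := by
  rw [eq_bot_iff]
  intro y hy
  obtain ⟨z, hz, rfl⟩ := mem_homologyFiltration.mp hy
  rw [h, Submodule.mem_bot] at hz
  rw [C.moduleCat_iCycles_injective n (hz.trans (map_zero _).symm), map_zero]
  exact zero_mem _

lemma homologyFiltration_eq_top {p n : ℤ} (h : F p n = ⊤) : homologyFiltration C F p n = ⊤ := by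
  rw [eq_top_iff]
  intro y _
  obtain ⟨z, rfl⟩ := C.moduleCat_homologyπ_surjective n y
  exact mem_homologyFiltration.mpr ⟨z, by rw [h]; trivial, rfl⟩

end HomologyFiltration

/-! ### Degeneration and the limit page -/

namespace FilteredComplex

variable {R : Type w} [CommRing R] {c : ComplexShape ℤ}
  {C : HomologicalComplex (ModuleCat.{v} R) c} {F : ℤ → ∀ n, Submodule R (C.X n)} {ε : ℤ}

lemma relBoundaries_eq {r p n q q' q'' m : ℤ} (h : p + ε = q) (h' : p + ε * r = q')
    (h'' : p - ε * (r - 1) = q'') (hm : n - ε = m) :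
    relBoundaries C F ε r p n =
      relCycles C F q q' n ⊔ (relCycles C F q'' p m).map (C.d m n).hom := by
  subst h h' h'' hm
  rfl

variable {cc : ℤ → ComplexShape (ℤ × ℤ)} (hc : ∀ i j, c.Rel i j ↔ i + ε = j)
  (hcc : ∀ r a b, (cc r).Rel a b ↔ a.1 + ε * r = b.1 ∧ a.2 + ε * (1 - r) = b.2)

include hc in
lemma relCycles_eq {p p' n m : ℤ} (hm : n + ε = m) :
    relCycles C F p p' n = F p n ⊓ (F p' m).comap (C.d n m).hom := by
  ext x
  rw [mem_relCycles, Submodule.mem_inf, Submodule.mem_comap]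
  refine and_congr_right fun _ => ⟨fun h => h m, fun h k => ?_⟩
  by_cases hk : c.Rel n k
  · obtain rfl : k = m := ((hc _ _).mp hk).symm.trans hm
    exact h
  · rw [C.moduleCat_d_eq_zero hk]
    exact zero_mem _

/-- When the filtration does not move at `a.1`, the numerator is contained in the first summand of
the denominator. -/
lemma page_subsingleton (r : ℤ) (a : ℤ × ℤ) (h : ∀ n, F (a.1 + ε) n = F a.1 n) :
    Subsingleton ((page C F ε cc hc hcc r).X a) := by
  refine subsingleton_of_forall_eq 0 fun y => ?_
  obtain ⟨x, rfl⟩ := pageπ_surjective hc hcc r a y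
  rw [pageπ_eq_zero_iff]
  exact Submodule.mem_sup_left (relCycles_mono (h _).ge (fun _ => le_rfl) x.2)

lemma page_d_eq_zero (r : ℤ)
    (h : ∀ p, (∀ n, F (p + ε) n = F p n) ∨ ∀ n, F (p + ε * r) n = ⊥) (a b : ℤ × ℤ) :
    (page C F ε cc hc hcc r).d a b = 0 := by
  by_cases hab : (cc r).Rel a b
  · ext y
    obtain h' | h' := h a.1
    · have := page_subsingleton (C := C) hc hcc r a h'
      rw [Subsingleton.elim y 0, map_zero, map_zero]
    · obtain ⟨x, rfl⟩ := pageπ_surjective hc hcc r a y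
      have hb := ((hcc r a b).mp hab).1
      have hx : (C.d (a.1 + a.2) (b.1 + b.2)).hom x = 0 := by
        have := (mem_relCycles.mp x.2).2 (b.1 + b.2)
        rwa [h', Submodule.mem_bot] at this
      exact (page_d_π hc hcc r hab x 0 hx.symm).trans (map_zero _)
  · exact HomologicalComplex.shape _ _ _ hab

/-- In the second case the numerator is the module of cycles in `F_p`, and the denominator is
generated by the cycles in `F_{p+ε}` and all boundaries in `F_p`. The cycles in `F_p` therefore
surject onto both sides with the same kernel. -/
lemma page_limit (hF : ∀ p n, F (p + ε) n ≤ F p n) (r : ℤ) (p q : ℤ)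
    (h : (∀ n, F (p + ε) n = F p n) ∨
      ∀ n, F (p + ε * r) n = ⊥ ∧ F (p - ε * (r - 1)) n = ⊤) :
    Nonempty ((page C F ε cc hc hcc r).X (p, q) ≃ₗ[R]
      homologyFiltration C F p (p + q) ⧸
        (homologyFiltration C F (p + ε) (p + q)).submoduleOf
          (homologyFiltration C F p (p + q))) := by
  obtain h | h := h
  · have h1 := page_subsingleton (C := C) hc hcc r (p, q) h
    have h2 : Subsingleton (homologyFiltration C F p (p + q) ⧸
        (homologyFiltration C F (p + ε) (p + q)).submoduleOf
          (homologyFiltration C F p (p + q))) := by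
      rw [Submodule.Quotient.subsingleton_iff, Submodule.submoduleOf,
        Submodule.comap_subtype_eq_top]
      exact homologyFiltration_mono C F (h _).ge
    exact ⟨LinearEquiv.ofSubsingleton _ _⟩
  · let W : Submodule R (C.cycles (p + q)) := (F p (p + q)).comap (C.iCycles (p + q)).hom
    have hW : ∀ z : W, (C.iCycles (p + q)).hom z ∈ pageCycles C F ε r (p, q) := fun z =>
      mem_relCycles.mpr ⟨z.2, fun m => by
        rw [C.moduleCat_d_iCycles]
        exact zero_mem _⟩
    let f : W →ₗ[R] (page C F ε cc hc hcc r).X (p, q) := pageπ C F hc hcc r (p, q) ∘ₗ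
      LinearMap.codRestrict _ ((C.iCycles (p + q)).hom ∘ₗ W.subtype) hW
    let g : W →ₗ[R] homologyFiltration C F p (p + q) ⧸
        (homologyFiltration C F (p + ε) (p + q)).submoduleOf
          (homologyFiltration C F p (p + q)) :=
      Submodule.mkQ _ ∘ₗ (C.homologyπ (p + q)).hom.restrict fun z hz =>
        mem_homologyFiltration.mpr ⟨z, hz, rfl⟩
    have hf : Function.Surjective f := by
      intro y
      obtain ⟨⟨x, hx⟩, rfl⟩ := pageπ_surjective hc hcc r (p, q) y
      obtain ⟨z, hz⟩ := C.moduleCat_exists_cycle _ x fun j => by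
        have := (mem_relCycles.mp hx).2 j
        rwa [(h j).1, Submodule.mem_bot] at this
      have hzW : z ∈ W := by
        change (C.iCycles (p + q)).hom z ∈ F p (p + q)
        rw [hz]
        exact (mem_relCycles.mp hx).1
      exact ⟨⟨z, hzW⟩, congrArg (pageπ C F hc hcc r (p, q)) (Subtype.ext hz)⟩
    have hg : Function.Surjective g := by
      refine (Submodule.mkQ_surjective _).comp ?_
      rintro ⟨y, hy⟩
      obtain ⟨z, hz, rfl⟩ := mem_homologyFiltration.mp hy
      exact ⟨⟨z, hz⟩, rfl⟩
    obtain ⟨e, -⟩ := LinearMap.exists_equiv_of_ker_eq f g hf hg fun z => by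
      have hg0 : g z = 0 ↔ (C.homologyπ (p + q)).hom z ∈
          homologyFiltration C F (p + ε) (p + q) := by
        rw [LinearMap.comp_apply, Submodule.mkQ_apply, Submodule.Quotient.mk_eq_zero]
        rfl
      have hf0 : f z = 0 ↔ (C.iCycles (p + q)).hom z ∈ relBoundaries C F ε r p (p + q) :=
        pageπ_eq_zero_iff hc hcc _
      rw [hf0, hg0, mem_relBoundaries hc, mem_homologyFiltration]
      constructor
      · rintro ⟨a, ha, m, b, -, hab⟩
        obtain ⟨y, rfl⟩ := C.moduleCat_exists_cycle _ a fun j => by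
          have := (mem_relCycles.mp ha).2 j
          rwa [(h j).1, Submodule.mem_bot] at this
        refine ⟨y, (mem_relCycles.mp ha).1, ?_⟩
        rw [eq_comm, ← sub_eq_zero, ← map_sub, C.moduleCat_homologyπ_eq_zero_iff]
        exact ⟨m, b, by rw [map_sub, ← hab, add_sub_cancel_left]⟩
      · rintro ⟨y, hy, hyz⟩
        rw [eq_comm, ← sub_eq_zero, ← map_sub, C.moduleCat_homologyπ_eq_zero_iff] at hyz
        obtain ⟨m, b, hb⟩ := hyz
        refine ⟨(C.iCycles _).hom y, mem_relCycles.mpr ⟨hy, fun j => ?_⟩, m, ?_⟩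
        · rw [C.moduleCat_d_iCycles]
          exact zero_mem _
        · rw [map_sub] at hb
          by_cases hm : c.Rel m (p + q)
          -- The primitive `b` meets no filtration constraint, since the step it must lie in is
          -- everything.
          · refine ⟨b, mem_relCycles.mpr ⟨by rw [(h m).2]; trivial, fun j => ?_⟩, ?_⟩
            · by_cases hj : c.Rel m j
              · obtain rfl := c.next_eq hm hj
                rw [hb]
                exact sub_mem z.2 (hF _ _ hy)
              · rw [C.moduleCat_d_eq_zero hj]
                exact zero_mem _
            · rw [hb, add_sub_cancel]
          · refine ⟨0, zero_mem _, ?_⟩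
            rw [C.moduleCat_d_eq_zero hm] at hb
            rw [map_zero, add_zero]
            exact (sub_eq_zero.mp hb.symm).symm
    exact ⟨e⟩

/-! ### The first page from contractions of the graded pieces -/

/-- A contraction of the graded piece `F_p / F_{p+ε}` of a filtered complex onto a module `T`:
this piece is identified with the homogeneous elements of a module `W` with a differential `D`,
which is the identity of `T` up to the homotopy `H`. -/
structure Contraction (C : HomologicalComplex (ModuleCat.{v} R) c)
    (F : ℤ → ∀ n, Submodule R (C.X n)) (ε p : ℤ) (W T : Type*) [AddCommGroup W] [Module R W]
    [AddCommGroup T] [Module R T] where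
  /-- the projection onto the graded piece -/
  ρ (n : ℤ) : C.X n →ₗ[R] W
  /-- a section of the projection in each degree -/
  σ (n : ℤ) : W → C.X n
  /-- the homogeneous component of an element -/
  component (n : ℤ) : W →ₗ[R] W
  /-- the differential of the graded piece -/
  D : W →ₗ[R] W
  /-- the homotopy -/
  H : W →ₗ[R] W
  /-- the inclusion of `T` -/
  α : T →ₗ[R] W
  /-- the projection onto `T` -/
  β : W →ₗ[R] T
  ρ_eq_zero_iff (n : ℤ) (x : C.X n) : x ∈ F p n → (ρ n x = 0 ↔ x ∈ F (p + ε) n)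
  ρ_d (n m : ℤ) (x : C.X n) : c.Rel n m → x ∈ F p n → ρ m ((C.d n m).hom x) = D (ρ n x)
  σ_mem (n : ℤ) (w : W) : σ n w ∈ F p n
  ρ_σ (n : ℤ) (w : W) : ρ n (σ n w) = component n w
  component_ρ (n : ℤ) (x : C.X n) : component n (ρ n x) = ρ n x
  D_component (n : ℤ) (w : W) : D (component n w) = component (n + ε) (D w)
  D_α (t : T) : D (α t) = 0
  β_D (w : W) : β (D w) = 0
  β_α (t : T) : β (α t) = t
  homotopy (w : W) : D (H w) + H (D w) + α (β w) = w

namespace Contraction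

variable {p : ℤ} {W T : Type*} [AddCommGroup W] [Module R W] [AddCommGroup T] [Module R T]
  (G : Contraction C F ε p W T)
include G

lemma ρ_eq_zero_of_mem (hF : ∀ p n, F (p + ε) n ≤ F p n) {n : ℤ} {x : C.X n}
    (hx : x ∈ F (p + ε) n) : G.ρ n x = 0 :=
  (G.ρ_eq_zero_iff n x (hF _ _ hx)).mpr hx

include hc

/-- On the graded piece `x` becomes a cycle, which by the homotopy formula equals `D (H (ρ x)) + α
(β (ρ x))`. If the last term vanishes, a lift of `H (ρ x)` has a differential agreeing with `x`
modulo `F_{p+ε}`. The converse is `β ∘ D = 0`. -/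
lemma mem_relBoundaries_one (hF : ∀ p n, F (p + ε) n ≤ F p n)
    (hdF : ∀ p n m (x : C.X n), x ∈ F p n → (C.d n m).hom x ∈ F p m) {n : ℤ} {x : C.X n}
    (hx : x ∈ relCycles C F p (p + ε * 1) n) :
    x ∈ relBoundaries C F ε 1 p n ↔ G.β (G.ρ n x) = 0 := by
  rw [mem_relBoundaries hc]
  constructor
  · rintro ⟨a, ha, m, b, hb, rfl⟩
    rw [sub_self, mul_zero, sub_zero] at hb
    rw [map_add, G.ρ_eq_zero_of_mem hF (mem_relCycles.mp ha).1, zero_add]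
    by_cases hm : c.Rel m n
    · rw [G.ρ_d m n b hm (mem_relCycles.mp hb).1, G.β_D]
    · rw [C.moduleCat_d_eq_zero hm, map_zero, map_zero]
  · intro h
    obtain ⟨m, hm⟩ : ∃ m, m + ε = n := ⟨n - ε, by ring⟩
    obtain ⟨hx1, hx2⟩ := mem_relCycles.mp hx
    have hD : G.D (G.ρ n x) = 0 := by
      rw [← G.ρ_d n (n + ε) x ((hc _ _).mpr rfl) hx1]
      have := hx2 (n + ε)
      rw [mul_one] at this
      exact G.ρ_eq_zero_of_mem hF this
    have hρ : G.ρ n ((C.d m n).hom (G.σ m (G.H (G.ρ n x)))) = G.ρ n x := by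
      rw [G.ρ_d m n _ ((hc _ _).mpr hm) (G.σ_mem _ _), G.ρ_σ, G.D_component, hm]
      have := G.homotopy (G.ρ n x)
      rw [hD, h, map_zero, map_zero, add_zero, add_zero] at this
      rw [this, G.component_ρ]
    have hy := G.σ_mem m (G.H (G.ρ n x))
    have hsub : x - (C.d m n).hom (G.σ m (G.H (G.ρ n x))) ∈ F (p + ε) n := by
      rw [← G.ρ_eq_zero_iff n _ (sub_mem hx1 (hdF _ _ _ _ hy)), map_sub, hρ, sub_self]
    refine ⟨_, mem_relCycles.mpr ⟨hsub, fun k => ?_⟩, m, _, mem_relCycles.mpr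
      ⟨?_, fun k => hdF _ _ _ _ hy⟩, sub_add_cancel _ _⟩
    · rw [mul_one]
      exact hdF _ _ _ _ hsub
    · rwa [sub_self, mul_zero, sub_zero]

lemma page_one_subsingleton (hF : ∀ p n, F (p + ε) n ≤ F p n)
    (hdF : ∀ p n m (x : C.X n), x ∈ F p n → (C.d n m).hom x ∈ F p m) (q : ℤ)
    (h : ∀ w, G.β (G.component (p + q) w) = 0) :
    Subsingleton ((page C F ε cc hc hcc 1).X (p, q)) := by
  refine subsingleton_of_forall_eq 0 fun y => ?_
  obtain ⟨x, rfl⟩ := pageπ_surjective hc hcc 1 (p, q) y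
  rw [pageπ_eq_zero_iff]
  refine (G.mem_relBoundaries_one hc hF hdF x.2).mpr ?_
  dsimp only
  rw [← G.component_ρ, h]

/-- The map `β ∘ ρ` on the numerator has the denominator as kernel. It is onto because `α t` lifts
through `σ`, and `D ∘ α = 0` puts the lift in the numerator. -/
lemma page_one_equiv (hF : ∀ p n, F (p + ε) n ≤ F p n)
    (hdF : ∀ p n m (x : C.X n), x ∈ F p n → (C.d n m).hom x ∈ F p m) (q : ℤ)
    (h : ∀ t, G.component (p + q) (G.α t) = G.α t) :
    Nonempty ((page C F ε cc hc hcc 1).X (p, q) ≃ₗ[R] T) := by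
  obtain ⟨e, -⟩ := LinearMap.exists_equiv_of_ker_eq (pageπ C F hc hcc 1 (p, q))
    ((G.β ∘ₗ G.ρ (p + q)) ∘ₗ Submodule.subtype _) (pageπ_surjective hc hcc 1 (p, q))
    (fun t => by
      refine ⟨⟨G.σ (p + q) (G.α t), mem_relCycles.mpr ⟨G.σ_mem _ _, fun m => ?_⟩⟩, ?_⟩
      · by_cases hm : c.Rel (p + q) m
        · rw [mul_one, ← G.ρ_eq_zero_iff m _ (hdF _ _ _ _ (G.σ_mem _ _)),
            G.ρ_d _ _ _ hm (G.σ_mem _ _), G.ρ_σ, h, G.D_α]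
        · rw [C.moduleCat_d_eq_zero hm]
          exact zero_mem _
      · change G.β (G.ρ (p + q) (G.σ (p + q) (G.α t))) = t
        rw [G.ρ_σ, h, G.β_α])
    (fun x => by
      rw [pageπ_eq_zero_iff]
      exact G.mem_relBoundaries_one hc hF hdF x.2)
  exact ⟨e⟩

end Contraction

end FilteredComplex

/-! ### Specialization to chain complexes (`ε = -1`) and cochain complexes (`ε = 1`) -/

section InducedBy

open FilteredComplex

variable {R : Type w} [CommRing R]

namespace ChainComplex

variable (C : ChainComplex (ModuleCat.{v} R) ℤ) (F : ℤ → ∀ n, Submodule R (C.X n))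

lemma down_rel_iff (i j : ℤ) : (ComplexShape.down ℤ).Rel i j ↔ i + -1 = j := by
  rw [ComplexShape.down_Rel]
  constructor <;> intro h <;> linarith

lemma page_rel_iff (r : ℤ) (a b : ℤ × ℤ) :
    (ComplexShape.up' (⟨-r, r - 1⟩ : ℤ × ℤ)).Rel a b ↔
      a.1 + -1 * r = b.1 ∧ a.2 + -1 * (1 - r) = b.2 := by
  rw [ComplexShape.up'_Rel, Prod.ext_iff]
  simp

lemma relCycles_eq_approxCycles (r p p' n : ℤ) (h : p + -1 * r = p') :
    relCycles C F p p' n = approxCycles C F r p n := by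
  obtain rfl : p - r = p' := by rw [← h]; ring
  exact relCycles_eq down_rel_iff (by ring)

lemma relBoundaries_eq_approxBoundaries (r p n : ℤ) :
    relBoundaries C F (-1) r p n = approxBoundaries C F r p n := by
  rw [relBoundaries_eq (q := p - 1) (q' := p + -1 * r) (q'' := p + r - 1) (m := n + 1) (by ring)
    rfl (by ring) (by ring), relCycles_eq_approxCycles C F (r - 1) _ _ _ (by ring),
    relCycles_eq_approxCycles C F (r - 1) _ _ _ (by ring), approxBoundaries]

variable {F} (hF : ∀ p n, F (p + -1) n ≤ F p n)

/-- The spectral sequence of a filtered chain complex is induced by the filtration. -/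
def inducedBySpectralSequence :
    InducedBy C F (spectralSequence _ down_rel_iff page_rel_iff hF) where
  proj r hr p q := pageπ C F down_rel_iff page_rel_iff r (p, q) ∘ₗ
    (LinearEquiv.ofEq _ _ (relCycles_eq_approxCycles C F r p _ (p + q) rfl).symm).toLinearMap
  proj_surjective r hr p q :=
    (pageπ_surjective down_rel_iff page_rel_iff r (p, q)).comp (LinearEquiv.surjective _)
  proj_eq_zero_iff r hr p q x := by
    rw [← relBoundaries_eq_approxBoundaries]
    exact pageπ_eq_zero_iff down_rel_iff page_rel_iff _
  d_proj r hr p q x y hy := by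
    exact page_d_π down_rel_iff page_rel_iff r (a := (p, q)) (b := (p - r, q + r - 1))
      ((page_rel_iff _ _ _).mpr ⟨by ring, by ring⟩) _ _ hy
  iso_proj r hr p q x y hxy z hz := by
    exact spectralSequence_iso_apply down_rel_iff page_rel_iff hF r (r + 1) hr rfl (p, q) _ _ hxy
      z hz

include hF in
lemma homologicalConvergence_spectralSequence (N : ℕ) (hbot : ∀ p n, p ≤ 0 → F p n = ⊥)
    (htop : ∀ (p n : ℤ), N ≤ p → F p n = ⊤) :
    HomologicalConvergence (spectralSequence _ down_rel_iff page_rel_iff hF) N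
      (fun n => C.homology n) (homologyFiltration C F) := by
  -- The filtration can only move for `1 ≤ p ≤ N`, and then `p - r ≤ 0` and `p + r - 1 ≥ N`.
  have key : ∀ r : ℤ, N ≤ r → ∀ p, (∀ n, F (p + -1) n = F p n) ∨
      ∀ n, F (p + -1 * r) n = ⊥ ∧ F (p - -1 * (r - 1)) n = ⊤ := by
    intro r hr p
    by_cases h0 : p ≤ 0
    · exact Or.inl fun n => by rw [hbot _ _ h0, hbot _ _ (by linarith)]
    by_cases hN : N < p
    · exact Or.inl fun n => by rw [htop _ _ hN.le, htop _ _ (by linarith)]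
    · exact Or.inr fun n => ⟨hbot _ _ (by linarith), htop _ _ (by linarith)⟩
  constructor
  · intro n p
    refine homologyFiltration_mono C F ?_
    have := hF (p + 1) n
    rwa [add_neg_cancel_right] at this
  · exact fun n => ⟨0, homologyFiltration_eq_bot C F (hbot _ _ le_rfl)⟩
  · exact fun n => ⟨N, homologyFiltration_eq_top C F (htop _ _ le_rfl)⟩
  · intro r hr hN a b
    exact page_d_eq_zero down_rel_iff page_rel_iff r
      (fun p => (key r hN p).imp_right fun h n => (h n).1) a b
  · intro r hr hN p q
    exact page_limit down_rel_iff page_rel_iff hF r p q (key r hN p)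

end ChainComplex

namespace CochainComplex

variable (C : CochainComplex (ModuleCat.{v} R) ℤ) (F : ℤ → ∀ n, Submodule R (C.X n))

lemma up_rel_iff (i j : ℤ) : (ComplexShape.up ℤ).Rel i j ↔ i + 1 = j :=
  Iff.rfl

lemma page_rel_iff (r : ℤ) (a b : ℤ × ℤ) :
    (ComplexShape.up' (⟨r, 1 - r⟩ : ℤ × ℤ)).Rel a b ↔
      a.1 + 1 * r = b.1 ∧ a.2 + 1 * (1 - r) = b.2 := by
  rw [ComplexShape.up'_Rel, Prod.ext_iff]
  simp

lemma relCycles_eq_approxCocycles (r p p' n : ℤ) (h : p + 1 * r = p') :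
    relCycles C F p p' n = approxCocycles C F r p n := by
  obtain rfl : p + r = p' := by rw [← h]; ring
  exact relCycles_eq up_rel_iff rfl

lemma relBoundaries_eq_approxCoboundaries (r p n : ℤ) :
    relBoundaries C F 1 r p n = approxCoboundaries C F r p n := by
  rw [relBoundaries_eq (q := p + 1) (q' := p + 1 * r) (q'' := p - r + 1) (m := n - 1) rfl
    rfl (by ring) rfl, relCycles_eq_approxCocycles C F (r - 1) _ _ _ (by ring),
    relCycles_eq_approxCocycles C F (r - 1) _ _ _ (by ring), approxCoboundaries]

variable {F} (hF : ∀ p n, F (p + 1) n ≤ F p n)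

/-- The spectral sequence of a filtered cochain complex is induced by the filtration. -/
def inducedBySpectralSequence :
    InducedBy C F (spectralSequence _ up_rel_iff page_rel_iff hF) where
  proj r hr p q := pageπ C F up_rel_iff page_rel_iff r (p, q) ∘ₗ
    (LinearEquiv.ofEq _ _ (relCycles_eq_approxCocycles C F r p _ (p + q) rfl).symm).toLinearMap
  proj_surjective r hr p q :=
    (pageπ_surjective up_rel_iff page_rel_iff r (p, q)).comp (LinearEquiv.surjective _)
  proj_eq_zero_iff r hr p q x := by
    rw [← relBoundaries_eq_approxCoboundaries]
    exact pageπ_eq_zero_iff up_rel_iff page_rel_iff _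
  d_proj r hr p q x y hy := by
    exact page_d_π up_rel_iff page_rel_iff r (a := (p, q)) (b := (p + r, q + 1 - r))
      ((page_rel_iff _ _ _).mpr ⟨by ring, by ring⟩) _ _ hy
  iso_proj r hr p q x y hxy z hz := by
    exact spectralSequence_iso_apply up_rel_iff page_rel_iff hF r (r + 1) hr rfl (p, q) _ _ hxy
      z hz

include hF in
lemma cohomologicalConvergence_spectralSequence (N : ℕ) (htop : ∀ p n, p ≤ 0 → F p n = ⊤)
    (hbot : ∀ (p n : ℤ), N ≤ p → F p n = ⊥) :
    CohomologicalConvergence (spectralSequence _ up_rel_iff page_rel_iff hF) N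
      (fun n => C.homology n) (homologyFiltration C F) := by
  -- Here the range is `0 ≤ p ≤ N - 1`, where `p + r ≥ N` and `p - (r - 1) ≤ 0`.
  have key : ∀ r : ℤ, N ≤ r → ∀ p, (∀ n, F (p + 1) n = F p n) ∨
      ∀ n, F (p + 1 * r) n = ⊥ ∧ F (p - 1 * (r - 1)) n = ⊤ := by
    intro r hr p
    by_cases h0 : p < 0
    · exact Or.inl fun n => by rw [htop _ _ h0.le, htop _ _ (by linarith)]
    by_cases hN : N ≤ p
    · exact Or.inl fun n => by rw [hbot _ _ hN, hbot _ _ (by linarith)]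
    · exact Or.inr fun n => ⟨hbot _ _ (by linarith), htop _ _ (by linarith)⟩
  constructor
  · exact fun n p => homologyFiltration_mono C F (hF p n)
  · exact fun n => ⟨0, homologyFiltration_eq_top C F (htop _ _ le_rfl)⟩
  · exact fun n => ⟨N, homologyFiltration_eq_bot C F (hbot _ _ le_rfl)⟩
  · intro r hr hN a b
    exact page_d_eq_zero up_rel_iff page_rel_iff r
      (fun p => (key r hN p).imp_right fun h n => (h n).1) a b
  · intro r hr hN p q
    exact page_limit up_rel_iff page_rel_iff hF r p q (key r hN p)

end CochainComplex

end InducedBy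

/-! ### From tiles to sets of simplices -/

section Geometry

variable {V : Type u} [DecidableEq V]

omit [DecidableEq V] in
lemma mem_closedSimplex_iff_subset {s t : Finset V} {x : V → ℝ} (hx : x ∈ closedSimplex s)
    (hpos : ∀ v ∈ s, 0 < x v) : x ∈ closedSimplex t ↔ s ⊆ t := by
  constructor
  · intro h v hv
    by_contra hvt
    exact (hpos v hv).ne' (h.2.1 v hvt)
  · intro h
    refine ⟨hx.1, fun v hv => hx.2.1 v fun hvs => hv (h hvs), ?_⟩
    rw [← hx.2.2]
    exact (Finset.sum_subset h fun v _ hv => hx.2.1 v hv).symm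

/-- The barycenter of a simplex. -/
def barycenter (s : Finset V) : V → ℝ := fun v => if v ∈ s then (s.card : ℝ)⁻¹ else 0

lemma barycenter_pos {s : Finset V} {v : V} (hv : v ∈ s) : 0 < barycenter s v := by
  rw [barycenter, if_pos hv, inv_pos, Nat.cast_pos, Finset.card_pos]
  exact ⟨v, hv⟩

lemma barycenter_mem {s : Finset V} (hs : s.Nonempty) : barycenter s ∈ closedSimplex s := by
  refine ⟨fun v => ?_, fun v hv => if_neg hv, ?_⟩
  · by_cases hv : v ∈ s
    · exact (barycenter_pos hv).le
    · exact (if_neg hv).ge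
  · rw [Finset.sum_congr rfl fun v hv => show barycenter s v = (s.card : ℝ)⁻¹ from if_pos hv,
      Finset.sum_const, nsmul_eq_mul, mul_inv_cancel₀]
    exact Nat.cast_ne_zero.mpr (Finset.card_pos.mpr hs).ne'

lemma barycenter_mem_iff {s t : Finset V} (hs : s.Nonempty) :
    barycenter s ∈ closedSimplex t ↔ s ⊆ t :=
  mem_closedSimplex_iff_subset (barycenter_mem hs) fun _ => barycenter_pos

namespace MorseTile

variable (T : MorseTile V)

/-- The simplices whose interiors are contained in the tile. -/
def faces : Finset (Finset V) :=
  T.simplex.powerset.filter fun s => T.opposite ⊆ s ∧ ¬ s ⊆ T.morseFace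

variable {T}

lemma mem_faces {s : Finset V} :
    s ∈ T.faces ↔ s ⊆ T.simplex ∧ T.opposite ⊆ s ∧ ¬ s ⊆ T.morseFace := by
  simp [faces]

/-- The empty set is excluded by its inclusion in the Morse face, even when the latter is empty. -/
lemma nonempty_of_mem_faces {s : Finset V} (hs : s ∈ T.faces) : s.Nonempty := by
  rw [Finset.nonempty_iff_ne_empty]
  rintro rfl
  exact (mem_faces.mp hs).2.2 (Finset.empty_subset _)

/-- Order convexity of the simplices of a tile; it is what makes the boundary restricted to a tile
square to zero. -/
lemma mem_faces_of_subset {s t r : Finset V} (hs : s ∈ T.faces) (hr : r ∈ T.faces) (hst : s ⊆ t)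
    (htr : t ⊆ r) : t ∈ T.faces :=
  mem_faces.mpr ⟨htr.trans (mem_faces.mp hr).1, (mem_faces.mp hs).2.1.trans hst,
    fun h => (mem_faces.mp hs).2.2 (hst.trans h)⟩

/-- A point with support `s` lies in a closed face exactly when the face contains `s`, so membership
in a tile depends on the support only. Avoiding the facet opposite to `v` means `v ∈ s`. -/
lemma mem_carrier_iff {s : Finset V} {x : V → ℝ} (hx : x ∈ closedSimplex s)
    (hpos : ∀ v ∈ s, 0 < x v) : x ∈ T.carrier ↔ s ∈ T.faces := by
  have key : ∀ t, x ∈ closedSimplex t ↔ s ⊆ t := fun t => mem_closedSimplex_iff_subset hx hpos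
  simp only [carrier, Set.mem_sdiff, Set.mem_union, Set.mem_iUnion, key, mem_faces,
    Finset.subset_erase, not_or, not_exists, not_and, not_not]
  constructor
  · rintro ⟨h1, h2, h3⟩
    exact ⟨h1, fun v hv => h2 v hv h1, h3⟩
  · rintro ⟨h1, h2, h3⟩
    exact ⟨h1, fun v hv _ => h2 hv, h3⟩

lemma barycenter_mem_carrier_iff {s : Finset V} (hs : s.Nonempty) :
    barycenter s ∈ T.carrier ↔ s ∈ T.faces :=
  mem_carrier_iff (barycenter_mem hs) fun _ => barycenter_pos

/-- The interiors of the simplices of a tile are matched by the addition and the deletion of a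
suitable vertex, with the exception of one simplex of dimension `k` if the tile is critical of
index `k`. -/
lemma exists_matching (T : MorseTile V) : ∃ v : V, (∀ s ∈ T.faces, insert v s ∈ T.faces) ∧
    (∀ s ∈ T.faces, ∀ t ∈ T.faces, s.erase v ∉ T.faces → t.erase v ∉ T.faces → s = t) ∧
    ∀ k : ℤ, T.IsCritical k ↔
      ∃ s ∈ T.faces, s.erase v ∉ T.faces ∧ (s.card : ℤ) = k + 1 := by
  have hins : ∀ v ∈ T.simplex, ∀ s ∈ T.faces, insert v s ∈ T.faces := by
    intro v hv s hs
    rw [mem_faces] at hs ⊢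
    exact ⟨Finset.insert_subset hv hs.1, hs.2.1.trans (Finset.subset_insert _ _),
      fun h => hs.2.2 ((Finset.subset_insert _ _).trans h)⟩
  -- a vertex all of whose deletions stay in the tile
  have acyclic : ∀ v ∈ T.simplex, (∀ s ∈ T.faces, s.erase v ∈ T.faces) →
      (∀ k, ¬ T.IsCritical k) → ∃ v : V, (∀ s ∈ T.faces, insert v s ∈ T.faces) ∧
        (∀ s ∈ T.faces, ∀ t ∈ T.faces, s.erase v ∉ T.faces → t.erase v ∉ T.faces → s = t) ∧
        ∀ k : ℤ, T.IsCritical k ↔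
          ∃ s ∈ T.faces, s.erase v ∉ T.faces ∧ (s.card : ℤ) = k + 1 := by
    intro v hv h hk
    exact ⟨v, hins v hv, fun s hs _ _ hs' => absurd (h s hs) hs', fun k =>
      ⟨fun h' => absurd h' (hk k), fun ⟨s, hs, hs', _⟩ => absurd (h s hs) hs'⟩⟩
  -- a vertex with exactly one exceptional simplex
  have critical : ∀ v ∈ T.simplex, ∀ c ∈ T.faces, c.erase v ∉ T.faces →
      (∀ s ∈ T.faces, s.erase v ∉ T.faces → s = c) →
      (∀ k : ℤ, T.IsCritical k ↔ (c.card : ℤ) = k + 1) →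
      ∃ v : V, (∀ s ∈ T.faces, insert v s ∈ T.faces) ∧
        (∀ s ∈ T.faces, ∀ t ∈ T.faces, s.erase v ∉ T.faces → t.erase v ∉ T.faces → s = t) ∧
        ∀ k : ℤ, T.IsCritical k ↔
          ∃ s ∈ T.faces, s.erase v ∉ T.faces ∧ (s.card : ℤ) = k + 1 := by
    intro v hv c hc hcv h hk
    refine ⟨v, hins v hv, fun s hs t ht hs' ht' => (h s hs hs').trans (h t ht ht').symm,
      fun k => ⟨fun h' => ⟨c, hc, hcv, (hk k).mp h'⟩, ?_⟩⟩
    rintro ⟨s, hs, hs', hsk⟩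
    rw [hk k, ← h s hs hs']
    exact hsk
  obtain hO | hO := T.opposite.eq_empty_or_nonempty
  · have hμ : T.morseFace = ∅ := by
      by_contra h
      have := T.opposite_nonempty (Finset.nonempty_iff_ne_empty.mpr h)
      rw [hO] at this
      exact Finset.not_nonempty_empty this
    have hF : ∀ s, s ∈ T.faces ↔ s ⊆ T.simplex ∧ s ≠ ∅ := by
      intro s
      rw [mem_faces, hO, hμ, Finset.subset_empty]
      simp
    -- Closed simplex: any vertex works, and only `{v}` is left over, its partner being the empty
    -- set.
    obtain ⟨v, hv⟩ := T.simplex_nonempty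
    refine critical v hv {v} ?_ ?_ ?_ ?_
    · rw [hF]
      simpa using hv
    · rw [hF]
      simp
    · intro s hs hs'
      rw [hF] at hs
      have : s.erase v = ∅ := by
        by_contra h
        exact hs' ((hF _).mpr ⟨(Finset.erase_subset _ _).trans hs.1, h⟩)
      rw [Finset.erase_eq_empty_iff] at this
      exact this.resolve_left hs.2
    · intro k
      have h3 : ¬ T.opposite = T.simplex := by
        rw [hO]
        exact T.simplex_nonempty.ne_empty.symm
      simp only [IsCritical, order, hO, hμ, Finset.card_empty, Finset.not_nonempty_empty,
        false_and, false_or, true_and, Finset.card_singleton]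
      rw [hO] at h3
      simp only [h3, false_and, or_false, Nat.cast_one]
      constructor <;> intro h <;> linarith
  have hO0 : ¬ T.order = 0 := by
    rw [order, Finset.card_eq_zero]
    exact hO.ne_empty
  obtain hμ | hμ := T.morseFace.eq_empty_or_nonempty
  · have hF : ∀ s, s ∈ T.faces ↔ s ⊆ T.simplex ∧ T.opposite ⊆ s := by
      intro s
      rw [mem_faces, hμ, Finset.subset_empty]
      refine and_congr_right fun _ => and_iff_left_of_imp fun h h' => ?_
      rw [h', Finset.subset_empty] at h
      exact hO.ne_empty h
    have hcrit : ∀ k, T.IsCritical k ↔ T.opposite = T.simplex ∧ k = T.dim := by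
      intro k
      simp [IsCritical, hO0, hμ]
    by_cases hOS : T.opposite = T.simplex
    -- Open simplex: there is a single simplex in the tile, and no vertex of it can be deleted.
    · obtain ⟨v, hv⟩ := T.simplex_nonempty
      refine critical v hv T.simplex ?_ ?_ ?_ ?_
      · rw [hF, hOS]
        exact ⟨subset_rfl, subset_rfl⟩
      · rw [hF, hOS]
        exact fun h => (Finset.mem_erase.mp (h.2 hv)).1 rfl
      · intro s hs _
        rw [hF, hOS] at hs
        exact hs.1.antisymm hs.2
      · intro k
        simp only [hcrit, hOS, true_and, dim]
        constructor <;> intro h <;> linarith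
    -- A vertex not opposite to any removed facet can always be deleted when there is no Morse face.
    · obtain ⟨v, hv, hvO⟩ := Finset.exists_of_ssubset (T.opposite_subset.ssubset_of_ne hOS)
      refine acyclic v hv (fun s hs => ?_) fun k hk => hOS ((hcrit k).mp hk).1
      rw [hF] at hs ⊢
      exact ⟨(Finset.erase_subset _ _).trans hs.1, Finset.subset_erase.mpr ⟨hs.2, hvO⟩⟩
  · have hOμ := T.opposite_subset_morseFace hμ
    have hcard := T.codim_morseFace hμ
    have hOS : ¬ T.opposite = T.simplex := by
      intro h
      have := Finset.card_le_card hOμ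
      rw [h] at this
      omega
    have hcrit : ∀ k, T.IsCritical k ↔ k = T.order ∧ (T.morseFace.card : ℤ) - 1 = k - 1 := by
      intro k
      simp [IsCritical, hO0, hμ, hOS]
    by_cases hOe : T.opposite = T.morseFace
    · have hne : T.morseFace ≠ T.simplex := by rwa [← hOe]
      -- Critical with a Morse face `μ`: every simplex of the tile contains `μ` strictly. For `v`
      -- outside `μ`, deletion fails only for `μ ∪ {v}`, whose dimension is the cardinality of `μ`,
      -- that is, the order.
      obtain ⟨v, hv, hvμ⟩ := Finset.exists_of_ssubset (T.morseFace_subset.ssubset_of_ne hne)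
      refine critical v hv (insert v T.morseFace) ?_ ?_ ?_ ?_
      · rw [mem_faces, hOe]
        exact ⟨Finset.insert_subset hv T.morseFace_subset, Finset.subset_insert _ _,
          fun h => hvμ (h (Finset.mem_insert_self _ _))⟩
      · rw [Finset.erase_insert hvμ, mem_faces]
        exact fun h => h.2.2 subset_rfl
      · intro s hs hs'
        rw [mem_faces, hOe] at hs hs'
        have h1 : T.morseFace ⊆ s.erase v := Finset.subset_erase.mpr ⟨hs.2.1, hvμ⟩
        have h2 : s.erase v ⊆ T.morseFace := by
          by_contra h
          exact hs' ⟨(Finset.erase_subset _ _).trans hs.1, h1, h⟩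
        have hvs : v ∈ s := by
          by_contra hvs
          rw [Finset.erase_eq_of_notMem hvs] at h2
          exact hs.2.2 h2
        rw [h1.antisymm h2, Finset.insert_erase hvs]
      · intro k
        rw [hcrit, order, hOe, Finset.card_insert_of_notMem hvμ]
        push_cast
        constructor
        · intro h
          linarith [h.1]
        · intro h
          constructor <;> linarith
    -- A vertex of the Morse face opposite to no removed facet: deleting it cannot push a simplex
    -- into the Morse face, which already contains it.
    · obtain ⟨v, hv, hvO⟩ := Finset.exists_of_ssubset (hOμ.ssubset_of_ne hOe)
      refine acyclic v (T.morseFace_subset hv) (fun s hs => ?_) fun k hk => ?_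
      · rw [mem_faces] at hs ⊢
        refine ⟨(Finset.erase_subset _ _).trans hs.1, Finset.subset_erase.mpr ⟨hs.2.1, hvO⟩,
          fun h => hs.2.2 fun w hw => ?_⟩
        by_cases hwv : w = v
        · rwa [hwv]
        · exact h (Finset.mem_erase.mpr ⟨hwv, hw⟩)
      · rw [hcrit, order] at hk
        refine hOe (Finset.eq_of_subset_of_card_le hOμ ?_)
        have : (T.morseFace.card : ℤ) = T.opposite.card := by linarith [hk.1, hk.2]
        exact_mod_cast this.le

end MorseTile

variable {K : PreAbstractSimplicialComplex V}

lemma barycenter_mem_realization_iff {s : Finset V} (hs : s.Nonempty) :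
    barycenter s ∈ K.realization ↔ s ∈ K.faces := by
  simp only [PreAbstractSimplicialComplex.realization, Set.mem_iUnion, barycenter_mem_iff hs,
    exists_prop]
  exact ⟨fun ⟨t, ht, hst⟩ => (K.isRelLowerSet_faces ht).2 hst hs, fun h => ⟨s, h, subset_rfl⟩⟩

namespace MorseTiling

variable (S : MorseTiling K)

/-- Barycenters test membership of open simplices, so the covering of the realization becomes a
covering of the set of simplices. -/
lemma exists_mem_faces_iff {s : Finset V} : (∃ i, s ∈ (S.tile i).faces) ↔ s ∈ K.faces := by
  constructor
  · rintro ⟨i, hi⟩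
    have hs := MorseTile.nonempty_of_mem_faces hi
    rw [← barycenter_mem_realization_iff hs, ← S.cover]
    exact Set.mem_iUnion.mpr ⟨i, (MorseTile.barycenter_mem_carrier_iff hs).mpr hi⟩
  · intro h
    have hs := (K.isRelLowerSet_faces h).1
    rw [← barycenter_mem_realization_iff hs, ← S.cover, Set.mem_iUnion] at h
    obtain ⟨i, hi⟩ := h
    exact ⟨i, (MorseTile.barycenter_mem_carrier_iff hs).mp hi⟩

lemma eq_of_mem_faces {s : Finset V} {i j : Fin S.numTiles} (hi : s ∈ (S.tile i).faces)
    (hj : s ∈ (S.tile j).faces) : i = j := by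
  by_contra h
  have hs := MorseTile.nonempty_of_mem_faces hi
  exact Set.disjoint_left.mp (S.disjoint i j h)
    ((MorseTile.barycenter_mem_carrier_iff hs).mpr hi)
    ((MorseTile.barycenter_mem_carrier_iff hs).mpr hj)

lemma mem_initial {p : ℤ} {x : V → ℝ} :
    x ∈ S.initial p ↔ ∃ i : Fin S.numTiles, (i : ℤ) < p ∧ x ∈ (S.tile i).carrier := by
  simp [initial]

end MorseTiling

namespace MorseShelling

variable (S : MorseShelling K)

lemma isClosedIn_initial (p : ℤ) : K.IsClosedIn (S.initial p) := by
  -- Clamping `p` to the interval from `0` to `N`, where closedness is given.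
  have h : S.initial p = S.initial ((min p S.numTiles).toNat : ℤ) := by
    ext x
    rw [S.mem_initial, S.mem_initial]
    refine exists_congr fun i => and_congr_left fun _ => ?_
    have := i.2
    omega
  rw [h]
  exact S.closed_initial _ (by omega)

lemma mem_subcomplex_iff {p : ℤ} {s : Finset V} : s ∈ (S.subcomplex p).faces ↔
    ∃ i : Fin S.numTiles, (i : ℤ) < p ∧ s ∈ (S.tile i).faces := by
  constructor
  · rintro ⟨hs, h⟩
    have hne := (K.isRelLowerSet_faces hs).1
    obtain ⟨i, hi, hx⟩ := S.mem_initial.mp (h (barycenter_mem hne))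
    exact ⟨i, hi, (MorseTile.barycenter_mem_carrier_iff hne).mp hx⟩
  · rintro ⟨i, hi, hs⟩
    have hsK : s ∈ K.faces := S.exists_mem_faces_iff.mp ⟨i, hs⟩
    have hne := (K.isRelLowerSet_faces hsK).1
    refine ⟨hsK, fun x hx => ?_⟩
    obtain ⟨Z, hZ, hZe⟩ := isClosed_induced_iff.mp (S.isClosedIn_initial p)
    have hreal : ∀ y ∈ closedSimplex s, y ∈ K.realization := fun y hy =>
      Set.mem_biUnion hsK hy
    have hiff : ∀ y ∈ closedSimplex s, (y ∈ Z ↔ y ∈ S.initial p) := fun y hy =>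
      Set.ext_iff.mp hZe ⟨y, hreal y hy⟩
    rw [← hiff x hx]
    -- For `0 < t < 1` this segment runs in the interior of `s`, hence in the tile `i`; its end `x`
    -- at `t = 0` lies in the union of the first tiles because that union is closed.
    let f : ℝ → V → ℝ := fun t => (1 - t) • x + t • barycenter s
    have hf : Continuous f := by fun_prop
    have hb := barycenter_mem hne
    have hfZ : ∀ t ∈ Set.Ioo (0 : ℝ) 1, f t ∈ Z := by
      intro t ht
      have h1 : 0 < 1 - t := sub_pos.mpr ht.2
      have hpos : ∀ v ∈ s, 0 < f t v := fun v hv =>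
        add_pos_of_nonneg_of_pos (mul_nonneg h1.le (hx.1 v)) (mul_pos ht.1 (barycenter_pos hv))
      have hft : f t ∈ closedSimplex s := by
        refine ⟨fun v => add_nonneg (mul_nonneg h1.le (hx.1 v)) (mul_nonneg ht.1.le (hb.1 v)),
          fun v hv => ?_, ?_⟩
        · simp [f, hx.2.1 v hv, hb.2.1 v hv]
        · simp only [f, Pi.add_apply, Pi.smul_apply, smul_eq_mul, Finset.sum_add_distrib,
            ← Finset.mul_sum, hx.2.2, hb.2.2]
          ring
      rw [hiff _ hft, S.mem_initial]
      exact ⟨i, hi, (MorseTile.mem_carrier_iff hft hpos).mpr hs⟩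
    have h0 : f 0 = x := by simp [f]
    rw [← h0]
    refine hZ.mem_of_tendsto (b := nhdsWithin (0 : ℝ) (Set.Ioi 0))
      ((hf.tendsto 0).mono_left nhdsWithin_le_nhds) ?_
    filter_upwards [Ioo_mem_nhdsGT (zero_lt_one' ℝ)] with t ht using hfZ t ht

lemma subcomplex_mono {p q : ℤ} (h : p ≤ q) {s : Finset V} (hs : s ∈ (S.subcomplex p).faces) :
    s ∈ (S.subcomplex q).faces := by
  rw [mem_subcomplex_iff] at hs ⊢
  obtain ⟨i, hi, hs⟩ := hs
  exact ⟨i, hi.trans_le h, hs⟩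

lemma notMem_subcomplex_of_nonpos {p : ℤ} (h : p ≤ 0) (s : Finset V) :
    s ∉ (S.subcomplex p).faces := by
  rw [mem_subcomplex_iff]
  rintro ⟨i, hi, -⟩
  omega

lemma mem_subcomplex_of_le {p : ℤ} (h : S.numTiles ≤ p) {s : Finset V} (hs : s ∈ K.faces) :
    s ∈ (S.subcomplex p).faces := by
  obtain ⟨i, hi⟩ := S.exists_mem_faces_iff.mpr hs
  exact S.mem_subcomplex_iff.mpr ⟨i, by have := i.2; omega, hi⟩

lemma mem_tile_faces_iff (i : Fin S.numTiles) (s : Finset V) : s ∈ (S.tile i).faces ↔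
    s ∈ (S.subcomplex (i + 1)).faces ∧ s ∉ (S.subcomplex i).faces := by
  simp only [mem_subcomplex_iff]
  constructor
  · intro h
    refine ⟨⟨i, by omega, h⟩, ?_⟩
    rintro ⟨j, hj, hs⟩
    have := S.eq_of_mem_faces h hs
    subst this
    omega
  · rintro ⟨⟨j, hj, hs⟩, h⟩
    have hij : ¬ (j : ℤ) < i := fun hji => h ⟨j, hji, hs⟩
    have : j = i := Fin.ext (by omega)
    rwa [← this]

/-- The filtration by subcomplexes is constant away from the tiles. -/
lemma mem_subcomplex_succ_iff {p : ℤ} (h : ∀ i : Fin S.numTiles, (i : ℤ) ≠ p) (s : Finset V) :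
    s ∈ (S.subcomplex (p + 1)).faces ↔ s ∈ (S.subcomplex p).faces := by
  rw [mem_subcomplex_iff, mem_subcomplex_iff]
  refine exists_congr fun i => and_congr_left fun _ => ?_
  have := h i
  omega

end MorseShelling

end Geometry

/-! ### Integer matrices of the boundary and of the vertex homotopy -/

section FaceMatrix

variable {V : Type u} [LinearOrder V]

/-- The coefficient of `t` in the boundary of `s`. -/
def faceCoeff (s t : Finset V) : ℤ := ∑ w ∈ s, if s.erase w = t then incidence s w else 0

lemma incidence_mul_self (s : Finset V) (v : V) : incidence s v * incidence s v = 1 := by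
  rw [incidence, ← mul_pow, neg_one_mul, neg_neg, one_pow]

lemma faceCoeff_erase {s : Finset V} {v : V} (hv : v ∈ s) :
    faceCoeff s (s.erase v) = incidence s v := by
  rw [faceCoeff, Finset.sum_eq_single_of_mem v hv, if_pos rfl]
  intro w hw hwv
  rw [if_neg]
  intro h
  have : v ∈ s.erase w := Finset.mem_erase.mpr ⟨hwv.symm, hv⟩
  rw [h] at this
  exact (Finset.mem_erase.mp this).1 rfl

lemma exists_of_faceCoeff_ne_zero {s t : Finset V} (h : faceCoeff s t ≠ 0) :
    ∃ w ∈ s, s.erase w = t := by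
  by_contra! h'
  exact h (Finset.sum_eq_zero fun w hw => if_neg (h' w hw))

lemma subset_of_faceCoeff_ne_zero {s t : Finset V} (h : faceCoeff s t ≠ 0) : t ⊆ s := by
  obtain ⟨w, -, rfl⟩ := exists_of_faceCoeff_ne_zero h
  exact Finset.erase_subset _ _

lemma card_of_faceCoeff_ne_zero {s t : Finset V} (h : faceCoeff s t ≠ 0) :
    s.card = t.card + 1 := by
  obtain ⟨w, hw, rfl⟩ := exists_of_faceCoeff_ne_zero h
  exact (Finset.card_erase_add_one hw).symm

lemma sum_faceCoeff_smul {A : Type*} [AddCommGroup A] (X : Finset (Finset V)) (s : Finset V)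
    (g : Finset V → A) : ∑ t ∈ X, faceCoeff s t • g t =
      ∑ w ∈ s, if s.erase w ∈ X then incidence s w • g (s.erase w) else 0 := by
  simp only [faceCoeff, Finset.sum_smul]
  rw [Finset.sum_comm]
  refine Finset.sum_congr rfl fun w _ => ?_
  simp only [ite_smul, zero_smul, Finset.sum_ite_eq]

/-- The facet opposite to `v` lacks `v`, so it is not `t`. The other facets correspond to those of
`s`, and exchanging the two deletions changes the sign. -/
lemma faceCoeff_insert {s t : Finset V} {v : V} (hvs : v ∉ s) (hvt : v ∈ t) :
    incidence (insert v s) v * faceCoeff (insert v s) t =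
      -(faceCoeff s (t.erase v) * incidence t v) := by
  rw [faceCoeff, faceCoeff, Finset.sum_insert hvs, Finset.erase_insert hvs,
    if_neg (show ¬ s = t from fun h => hvs (h ▸ hvt)), zero_add, Finset.mul_sum, Finset.sum_mul,
    ← Finset.sum_neg_distrib]
  refine Finset.sum_congr rfl fun w hw => ?_
  have hwv : w ≠ v := fun h => hvs (h ▸ hw)
  have hvw : v ∉ s.erase w := fun h => hvs (Finset.mem_of_mem_erase h)
  have he : (insert v s).erase w = insert v (s.erase w) := Finset.erase_insert_of_ne hwv.symm
  have hiff : (insert v s).erase w = t ↔ s.erase w = t.erase v := by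
    rw [he]
    constructor
    · rintro rfl
      rw [Finset.erase_insert hvw]
    · intro h
      rw [h, Finset.insert_erase hvt]
  by_cases h : s.erase w = t.erase v
  · rw [if_pos h, if_pos (hiff.mpr h)]
    have := incidence_anticomm (insert v s) (Finset.mem_insert_self v s)
      (Finset.mem_insert_of_mem hw) hwv.symm
    rw [Finset.erase_insert hvs, hiff.mpr h] at this
    have h1 := incidence_mul_self (insert v s) v
    have h2 := incidence_mul_self t v
    linear_combination incidence (insert v s) v * incidence t v * this -
      incidence s w * incidence t v * h1 -
      incidence (insert v s) v * incidence (insert v s) w * h2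
  · rw [if_neg h, if_neg fun h' => h (hiff.mp h')]
    simp

/-- Adding and deleting the vertex `v` is a homotopy from the identity to zero. -/
lemma faceCoeff_homotopy (v : V) (s t : Finset V) :
    (if v ∈ t then faceCoeff s (t.erase v) * incidence t v else 0) +
      (if v ∉ s then incidence (insert v s) v * faceCoeff (insert v s) t else 0) =
    if s = t then 1 else 0 := by
  by_cases hvs : v ∈ s <;> by_cases hvt : v ∈ t
  · rw [if_pos hvt, if_neg (not_not.mpr hvs), add_zero]
    split_ifs with h
    · rw [h, faceCoeff_erase hvt, incidence_mul_self]
    · rw [mul_eq_zero_of_left]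
      by_contra h'
      obtain ⟨w, hw, hwt⟩ := exists_of_faceCoeff_ne_zero h'
      have hwv : w = v := by
        by_contra hwv
        have : v ∈ s.erase w := Finset.mem_erase.mpr ⟨Ne.symm hwv, hvs⟩
        rw [hwt] at this
        exact (Finset.mem_erase.mp this).1 rfl
      rw [hwv] at hwt
      exact h (by rw [← Finset.insert_erase hvs, hwt, Finset.insert_erase hvt])
  · rw [if_neg hvt, if_neg (not_not.mpr hvs), if_neg (show ¬ s = t from fun h => hvt (h ▸ hvs)), add_zero]
  · rw [if_pos hvt, if_pos hvs, if_neg (show ¬ s = t from fun h => hvs (h ▸ hvt)),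
      faceCoeff_insert hvs hvt, add_neg_cancel]
  · rw [if_neg hvt, if_pos hvs, zero_add]
    split_ifs with h
    · rw [← h]
      nth_rw 3 [← Finset.erase_insert hvs]
      rw [faceCoeff_erase (Finset.mem_insert_self v s), incidence_mul_self]
    · rw [mul_eq_zero_of_right]
      by_contra h'
      obtain ⟨w, hw, hwt⟩ := exists_of_faceCoeff_ne_zero h'
      have hwv : v = w := by
        by_contra hwv
        refine hvt ?_
        rw [← hwt]
        exact Finset.mem_erase.mpr ⟨hwv, Finset.mem_insert_self _ _⟩
      rw [← hwv, Finset.erase_insert hvs] at hwt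
      exact h hwt

open scoped Matrix

variable (A : Finset (Finset V)) (v : V)

/-- The simplices of `A` from which the vertex `v` cannot be deleted. -/
abbrev Unmatched : Type u := {s : A // s.1.erase v ∉ A}

/-- The differential of the complex of cochains on a set `A` of simplices. -/
def faceMatrix : Matrix A A ℤ := fun s t => faceCoeff s.1 t.1

/-- The homotopy given by a vertex on the complex of cochains on a set of simplices. -/
def homotopyMatrix : Matrix A A ℤ :=
  fun t s => if v ∈ s.1 ∧ s.1.erase v = t.1 then incidence s.1 v else 0

/-- The cocycles attached to the unmatched simplices. -/
def unmatchedCocycle : Matrix A (Unmatched A v) ℤ :=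
  fun s j => faceCoeff s.1 (j.1.1.erase v) * incidence j.1.1 v

/-- The restriction to the unmatched simplices. -/
def unmatchedRestriction : Matrix (Unmatched A v) A ℤ := fun j s => if j.1 = s then 1 else 0

variable {A v}

lemma Unmatched.mem (j : Unmatched A v) : v ∈ j.1.1 := by
  by_contra h
  refine j.2 ?_
  rw [Finset.erase_eq_of_notMem h]
  exact j.1.2

/-- By convexity every simplex between `u` and `s` belongs to `A`, so restricting to `A` drops no
term of the usual cancellation. -/
lemma faceMatrix_mul_self (hA : ∀ s ∈ A, ∀ r ∈ A, ∀ t, s ⊆ t → t ⊆ r → t ∈ A) :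
    faceMatrix A * faceMatrix A = 0 := by
  ext s u
  rw [Matrix.mul_apply, Matrix.zero_apply]
  have h1 := sum_faceCoeff_smul A s.1 fun t => faceCoeff t u.1
  rw [← Finset.sum_coe_sort] at h1
  refine h1.trans ?_
  refine Eq.trans (Finset.sum_congr rfl fun w _ => ?_)
    (sum_incidence_eq_zero s.1 fun t => if t = u.1 then (1 : ℤ) else 0)
  have h2 : incidence s.1 w * faceCoeff (s.1.erase w) u.1 = ∑ x ∈ s.1.erase w,
      (incidence s.1 w * incidence (s.1.erase w) x) •
        if (s.1.erase w).erase x = u.1 then (1 : ℤ) else 0 := by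
    simp [faceCoeff, Finset.mul_sum]
  rw [← h2]
  split_ifs with h
  · rfl
  · have h0 : faceCoeff (s.1.erase w) u.1 = 0 := by
      by_contra h'
      exact h (hA _ u.2 _ s.2 _ (subset_of_faceCoeff_ne_zero h') (Finset.erase_subset _ _))
    rw [h0, mul_zero]

/-- This is `faceCoeff_homotopy` cut down to `A`. Insertions of `v` stay in `A`; the terms lost to
deletions that leave `A` are those of the unmatched simplices, and the third product restores them.
-/
lemma faceMatrix_homotopy [Fintype (Unmatched A v)] (hv : ∀ s ∈ A, insert v s ∈ A) :
    faceMatrix A * homotopyMatrix A v + homotopyMatrix A v * faceMatrix A +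
      unmatchedCocycle A v * unmatchedRestriction A v = 1 := by
  ext s t
  have h1 : (faceMatrix A * homotopyMatrix A v) s t = if v ∈ t.1 ∧ t.1.erase v ∈ A then
      faceCoeff s.1 (t.1.erase v) * incidence t.1 v else 0 := by
    rw [Matrix.mul_apply]
    split_ifs with h
    · rw [Finset.sum_eq_single_of_mem (⟨_, h.2⟩ : A) (Finset.mem_univ _)]
      · simp [faceMatrix, homotopyMatrix, h.1]
      · intro r _ hr
        rw [homotopyMatrix, if_neg, mul_zero]
        exact fun h' => hr (Subtype.ext h'.2.symm)
    · refine Finset.sum_eq_zero fun r _ => ?_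
      rw [homotopyMatrix, if_neg, mul_zero]
      exact fun h' => h ⟨h'.1, by rw [h'.2]; exact r.2⟩
  have h2 : (homotopyMatrix A v * faceMatrix A) s t = if v ∉ s.1 then
      incidence (insert v s.1) v * faceCoeff (insert v s.1) t.1 else 0 := by
    rw [Matrix.mul_apply]
    by_cases h : v ∉ s.1
    · rw [if_pos h, Finset.sum_eq_single_of_mem (⟨_, hv _ s.2⟩ : A) (Finset.mem_univ _)]
      · simp [faceMatrix, homotopyMatrix, h]
      · intro r _ hr
        rw [homotopyMatrix, if_neg, zero_mul]
        rintro ⟨h3, h4⟩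
        exact hr (Subtype.ext ((Finset.insert_erase h3).symm.trans (congrArg (insert v) h4)))
    · rw [if_neg h]
      refine Finset.sum_eq_zero fun r _ => ?_
      rw [homotopyMatrix, if_neg, zero_mul]
      rintro ⟨-, h4⟩
      exact h fun h5 => (Finset.mem_erase.mp (h4 ▸ h5)).1 rfl
  have h3 : (unmatchedCocycle A v * unmatchedRestriction A v) s t = if t.1.erase v ∉ A then
      faceCoeff s.1 (t.1.erase v) * incidence t.1 v else 0 := by
    rw [Matrix.mul_apply]
    by_cases h : t.1.erase v ∉ A
    · rw [if_pos h, Finset.sum_eq_single_of_mem (⟨t, h⟩ : Unmatched A v) (Finset.mem_univ _)]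
      · simp [unmatchedCocycle, unmatchedRestriction]
      · intro r _ hr
        rw [unmatchedRestriction, if_neg, mul_zero]
        exact fun h' => hr (Subtype.ext h')
    · rw [if_neg h]
      refine Finset.sum_eq_zero fun r _ => ?_
      rw [unmatchedRestriction, if_neg, mul_zero]
      rintro rfl
      exact h r.2
  have h4 := faceCoeff_homotopy v s.1 t.1
  rw [Matrix.add_apply, Matrix.add_apply, h1, h2, h3, Matrix.one_apply]
  simp only [Subtype.ext_iff]
  rw [← h4]
  by_cases h5 : t.1.erase v ∈ A
  · simp [h5]
  · have : v ∈ t.1 := Unmatched.mem ⟨t, h5⟩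
    simp [h5, this, add_comm]

/-- Unmatched simplices contain `v`, so between two of them only the deletion term of
`faceCoeff_homotopy` remains. -/
lemma unmatchedRestriction_mul_cocycle [DecidableEq (Unmatched A v)] :
    unmatchedRestriction A v * unmatchedCocycle A v = 1 := by
  ext i j
  rw [Matrix.mul_apply, Finset.sum_eq_single_of_mem i.1 (Finset.mem_univ _)]
  · have h := faceCoeff_homotopy v i.1.1 j.1.1
    rw [if_pos j.mem, if_neg (not_not.mpr i.mem), add_zero] at h
    simp only [unmatchedRestriction, unmatchedCocycle, if_true, one_mul, h, Matrix.one_apply,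
      Subtype.ext_iff]
  · intro s _ hs
    rw [unmatchedRestriction, if_neg (Ne.symm hs), zero_mul]

/-- A facet `t` in `A` of the unmatched simplex `j` has another dimension, hence is matched. Then `t
\ {v} ⊆ j \ {v} ⊆ j` and convexity would put `j \ {v}` in `A`. -/
lemma unmatchedRestriction_mul_faceMatrix (hA : ∀ s ∈ A, ∀ r ∈ A, ∀ t, s ⊆ t → t ⊆ r → t ∈ A)
    [Subsingleton (Unmatched A v)] : unmatchedRestriction A v * faceMatrix A = 0 := by
  ext j t
  rw [Matrix.mul_apply, Finset.sum_eq_single_of_mem j.1 (Finset.mem_univ _), Matrix.zero_apply]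
  · simp only [unmatchedRestriction, if_true, one_mul, faceMatrix]
    by_contra h
    have hsub := subset_of_faceCoeff_ne_zero h
    have hcard := card_of_faceCoeff_ne_zero h
    have ht : t.1.erase v ∈ A := by
      by_contra ht
      have := congrArg (fun i : Unmatched A v => i.1.1.card)
        (Subsingleton.elim (⟨t, ht⟩ : Unmatched A v) j)
      dsimp only at this
      omega
    exact j.2 (hA _ ht _ j.1.2 _ (Finset.erase_subset_erase v hsub) (Finset.erase_subset _ _))
  · intro s _ hs
    rw [unmatchedRestriction, if_neg (Ne.symm hs), zero_mul]

/-- With `D * D = 0`, the homotopy formula shows that the idempotent `X * Y` commutes with `D`; then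
`D * X = D * X * Y * X = X * Y * D * X = 0`. -/
lemma faceMatrix_mul_unmatchedCocycle
    (hA : ∀ s ∈ A, ∀ r ∈ A, ∀ t, s ⊆ t → t ⊆ r → t ∈ A) (hv : ∀ s ∈ A, insert v s ∈ A)
    [Subsingleton (Unmatched A v)] : faceMatrix A * unmatchedCocycle A v = 0 := by
  classical
  have : Fintype (Unmatched A v) := Fintype.ofFinite _
  set D := faceMatrix A
  set H := homotopyMatrix A v
  set X := unmatchedCocycle A v
  set Y := unmatchedRestriction A v
  have hDD : D * D = 0 := faceMatrix_mul_self hA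
  have hh : D * H + H * D + X * Y = 1 := faceMatrix_homotopy hv
  have hYX : Y * X = 1 := unmatchedRestriction_mul_cocycle
  have hYD : Y * D = 0 := unmatchedRestriction_mul_faceMatrix hA
  have h1 : D * (X * Y) = (X * Y) * D := by
    have e : X * Y = 1 - (D * H + H * D) := eq_sub_of_add_eq' hh
    rw [e, Matrix.mul_sub, Matrix.sub_mul, Matrix.mul_add, Matrix.add_mul, Matrix.mul_one,
      Matrix.one_mul, ← Matrix.mul_assoc D D, hDD, Matrix.mul_assoc H D D, hDD, Matrix.zero_mul,
      Matrix.mul_zero, zero_add, add_zero, Matrix.mul_assoc]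
  calc D * X = D * (X * Y) * X := by rw [Matrix.mul_assoc, Matrix.mul_assoc, hYX, Matrix.mul_one]
    _ = 0 := by
      rw [h1, Matrix.mul_assoc X, hYD, Matrix.mul_zero, Matrix.zero_mul]

lemma card_eq_of_unmatchedCocycle_ne_zero {s : A} {j : Unmatched A v}
    (h : unmatchedCocycle A v s j ≠ 0) : s.1.card = j.1.1.card := by
  rw [card_of_faceCoeff_ne_zero (left_ne_zero_of_mul h), Finset.card_erase_add_one j.mem]

/-! ### Matrices of integers acting on functions with values in a module -/

section Action

variable {l m n : Type*} [Fintype m] [Fintype n] (R : Type*) [CommRing R]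
  (M : Type*) [AddCommGroup M] [Module R M]

/-- The action of a matrix of integers on functions with values in a module. -/
def matrixAction (B : Matrix l m ℤ) : (m → M) →ₗ[R] (l → M) where
  toFun f i := ∑ j, B i j • f j
  map_add' f g := by
    ext i
    simp [Finset.sum_add_distrib]
  map_smul' c f := by
    ext i
    simp only [Pi.smul_apply, RingHom.id_apply, Finset.smul_sum]
    exact Finset.sum_congr rfl fun j _ => smul_comm _ _ _

variable {R M}

lemma matrixAction_apply (B : Matrix l m ℤ) (f : m → M) (i : l) :
    matrixAction R M B f i = ∑ j, B i j • f j :=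
  rfl

lemma matrixAction_mul (B : Matrix l m ℤ) (B' : Matrix m n ℤ) (f : n → M) :
    matrixAction R M B (matrixAction R M B' f) = matrixAction R M (B * B') f := by
  ext i
  simp only [matrixAction_apply, Matrix.mul_apply, Finset.smul_sum, Finset.sum_smul, mul_smul]
  exact Finset.sum_comm

lemma matrixAction_add (B B' : Matrix l m ℤ) (f : m → M) :
    matrixAction R M (B + B') f = matrixAction R M B f + matrixAction R M B' f := by
  ext i
  simp [matrixAction_apply, add_smul, Finset.sum_add_distrib]

lemma matrixAction_zero (f : m → M) : matrixAction R M (0 : Matrix l m ℤ) f = 0 := by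
  ext i
  simp [matrixAction_apply]

lemma matrixAction_one [DecidableEq m] (f : m → M) :
    matrixAction R M (1 : Matrix m m ℤ) f = f := by
  ext i
  simp [matrixAction_apply, Matrix.one_apply, ite_smul]

end Action

end FaceMatrix

/-! ### Restricting chains and cochains to the simplices of a tile -/

section TileContraction

open FilteredComplex
open scoped Matrix

variable {V : Type u} [LinearOrder V]

section Restriction

variable (R : Type w) [CommRing R] (M : Type v) [AddCommGroup M] [Module R M]
  (K : PreAbstractSimplicialComplex V) (A : Finset (Finset V))

/-- The component of degree `n` of a cochain on a set of simplices. -/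
def homogeneousComponent (n : ℤ) : (A → M) →ₗ[R] (A → M) where
  toFun f s := if (s.1.card : ℤ) = n + 1 then f s else 0
  map_add' f g := by
    ext s
    simp only [Pi.add_apply]
    split_ifs <;> simp
  map_smul' c f := by
    ext s
    simp only [Pi.smul_apply, RingHom.id_apply]
    split_ifs <;> simp

/-- The restriction of cochains to a set of simplices. -/
def cochainRestriction (n : ℤ) : (K.Simplex n → M) →ₗ[R] (A → M) where
  toFun f s := extendCochain M K n f s.1
  map_add' f g := by
    ext s
    simp only [Pi.add_apply, extendCochain]
    split_ifs <;> simp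
  map_smul' c f := by
    ext s
    simp only [Pi.smul_apply, RingHom.id_apply, extendCochain]
    split_ifs <;> simp

/-- The restriction of chains to a set of simplices. -/
def chainRestriction (n : ℤ) : (K.Simplex n →₀ M) →ₗ[R] (A → M) :=
  cochainRestriction R M K A n ∘ₗ Finsupp.lcoeFun

/-- The extension by zero of a cochain on a set of simplices. -/
def liftCochain (n : ℤ) (f : A → M) (s : K.Simplex n) : M :=
  if h : s.1 ∈ A then f ⟨s.1, h⟩ else 0

variable {R M K A}

omit [LinearOrder V] in
lemma cochainRestriction_apply (n : ℤ) (f : K.Simplex n → M) (s : A) :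
    cochainRestriction R M K A n f s = extendCochain M K n f s.1 :=
  rfl

omit [LinearOrder V] in
lemma extendCochain_of_card_ne {n : ℤ} {t : Finset V} (h : (t.card : ℤ) ≠ n + 1)
    (f : K.Simplex n → M) : extendCochain M K n f t = 0 :=
  dif_neg fun h' => h h'.2

lemma extendCochain_single {n : ℤ} (s : K.Simplex n) (y : M) (t : Finset V) :
    extendCochain M K n (Finsupp.single s y) t = if s.1 = t then y else 0 := by
  classical
  rw [extendCochain]
  split_ifs with h h' h'
  · rw [show s = ⟨t, h⟩ from Subtype.ext h', Finsupp.single_eq_same]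
  · rw [Finsupp.single_eq_of_ne]
    exact fun h'' => h' (congrArg Subtype.val h'').symm
  · exact absurd (h' ▸ s.2) h
  · rfl

lemma extendCochain_elementaryChain {n : ℤ} {r t : Finset V} (ht : t ∈ K.faces)
    (hr : (r.card : ℤ) = n + 1) (y : M) :
    extendCochain M K n (elementaryChain R M K n r y) t = if r = t then y else 0 := by
  rw [elementaryChain]
  split_ifs with h h' h'
  · rw [Finsupp.lsingle_apply, extendCochain_single, if_pos h']
  · rw [Finsupp.lsingle_apply, extendCochain_single, if_neg h']
  · exact absurd ⟨h' ▸ ht, hr⟩ h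
  · rw [extendCochain]
    split_ifs <;> rfl

lemma cochainRestriction_liftCochain (hA : ∀ s ∈ A, s ∈ K.faces) (n : ℤ) (f : A → M) :
    cochainRestriction R M K A n (liftCochain M K A n f) = homogeneousComponent R M A n f := by
  ext s
  simp only [cochainRestriction_apply, extendCochain, homogeneousComponent, liftCochain,
    LinearMap.coe_mk, AddHom.coe_mk, hA s.1 s.2, true_and, s.2, dite_true]
  rfl

omit [LinearOrder V] in
lemma homogeneousComponent_cochainRestriction (n : ℤ) (f : K.Simplex n → M) :
    homogeneousComponent R M A n (cochainRestriction R M K A n f) =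
      cochainRestriction R M K A n f := by
  ext s
  change (if (s.1.card : ℤ) = n + 1 then extendCochain M K n f s.1 else 0) =
    extendCochain M K n f s.1
  split_ifs with h
  · rfl
  · exact (extendCochain_of_card_ne h f).symm

omit [LinearOrder V] in
lemma cochainRestriction_eq_zero_iff {n : ℤ} {f : K.Simplex n → M} :
    cochainRestriction R M K A n f = 0 ↔ ∀ s : K.Simplex n, s.1 ∈ A → f s = 0 := by
  constructor
  · intro h s hs
    have := congrFun h ⟨s.1, hs⟩
    rwa [cochainRestriction_apply, extendCochain, dif_pos s.2] at this
  · intro h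
    ext s
    rw [cochainRestriction_apply, extendCochain]
    split_ifs with h'
    · exact h ⟨s.1, h'⟩ s.2
    · rfl

-- Functions on `A` mix all dimensions; a matrix whose nonzero entries shift dimension uniformly is
-- compatible with homogeneous components.
omit [LinearOrder V] in
lemma matrixAction_homogeneousComponent {B : Matrix A A ℤ} {n m : ℤ}
    (h : ∀ s t, B s t ≠ 0 → ((t.1.card : ℤ) = n + 1 ↔ (s.1.card : ℤ) = m + 1)) (f : A → M) :
    matrixAction R M B (homogeneousComponent R M A n f) =
      homogeneousComponent R M A m (matrixAction R M B f) := by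
  ext s
  change ∑ t, B s t • (if (t.1.card : ℤ) = n + 1 then f t else 0) =
    if (s.1.card : ℤ) = m + 1 then ∑ t, B s t • f t else 0
  split_ifs with hs
  · refine Finset.sum_congr rfl fun t _ => ?_
    by_cases hB : B s t = 0
    · rw [hB, zero_smul, zero_smul]
    · rw [if_pos ((h s t hB).mpr hs)]
  · refine Finset.sum_eq_zero fun t _ => ?_
    by_cases hB : B s t = 0
    · rw [hB, zero_smul]
    · rw [if_neg fun h' => hs ((h s t hB).mp h'), smul_zero]

omit [LinearOrder V] in
lemma homogeneousComponent_matrixAction {J : Type*} [Fintype J] {B : Matrix A J ℤ} {n : ℤ}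
    (h : ∀ s j, B s j ≠ 0 → (s.1.card : ℤ) = n + 1) (f : J → M) :
    homogeneousComponent R M A n (matrixAction R M B f) = matrixAction R M B f := by
  ext s
  change (if (s.1.card : ℤ) = n + 1 then ∑ t, B s t • f t else 0) = ∑ t, B s t • f t
  split_ifs with hs
  · rfl
  · refine (Finset.sum_eq_zero fun j _ => ?_).symm
    rw [not_not.mp fun hB => hs (h s j hB), zero_smul]

omit [LinearOrder V] in
lemma matrixAction_homogeneousComponent_eq_zero {J : Type*} {B : Matrix J A ℤ} {n : ℤ}
    (h : ∀ j s, B j s ≠ 0 → (s.1.card : ℤ) ≠ n + 1) (f : A → M) :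
    matrixAction R M B (homogeneousComponent R M A n f) = 0 := by
  ext j
  refine Finset.sum_eq_zero fun s _ => ?_
  change B j s • (if (s.1.card : ℤ) = n + 1 then f s else 0) = 0
  split_ifs with hs
  · rw [not_not.mp fun hB => h j s hB hs, zero_smul]
  · rw [smul_zero]

/-- Restriction to a set `A` of simplices turns the coboundary of cochains vanishing on all other
faces of the elements of `A` into the face matrix. -/
lemma cochainRestriction_coboundary {X : Set (Finset V)}
    (hX : ∀ s ∈ A, ∀ t ∈ K.faces, t ⊆ s → t ∉ A → t ∈ X)
    {n m : ℤ} (hnm : n + 1 = m) {f : K.Simplex n → M}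
    (hf : ∀ s : K.Simplex n, s.1 ∈ X → f s = 0) (hA : ∀ s ∈ A, s ∈ K.faces) :
    cochainRestriction R M K A m (simplicialCoboundary R M K n m f) =
      matrixAction R M (faceMatrix A) (cochainRestriction R M K A n f) := by
  ext s
  rw [matrixAction_apply]
  by_cases hs : (s.1.card : ℤ) = m + 1
  · have h1 := sum_faceCoeff_smul A s.1 fun t => extendCochain M K n f t
    rw [← Finset.sum_coe_sort] at h1
    refine Eq.trans ?_ h1.symm
    rw [cochainRestriction_apply, extendCochain, dif_pos ⟨hA _ s.2, hs⟩]
    refine Finset.sum_congr rfl fun w _ => ?_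
    dsimp only
    split_ifs with h
    · rfl
    · rw [extendCochain]
      split_ifs with h'
      · rw [hf _ (hX _ s.2 _ h'.1 (Finset.erase_subset _ _) h), smul_zero]
      · rw [smul_zero]
  · rw [cochainRestriction_apply, extendCochain_of_card_ne hs]
    refine (Finset.sum_eq_zero fun t _ => ?_).symm
    by_cases h : faceMatrix A s t = 0
    · rw [h, zero_smul]
    · have := card_of_faceCoeff_ne_zero h
      rw [cochainRestriction_apply, extendCochain_of_card_ne, smul_zero]
      rw [this] at hs
      push_cast at hs
      intro h'
      exact hs (by linarith)

/-- Restriction to a set `A` of simplices turns the boundary of chains on simplices whose faces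
in `A` are proper only for elements of `A` into the transpose of the face matrix. -/
lemma chainRestriction_boundary {X : Set (Finset V)} (hX : ∀ s ∈ X, s ∉ A → ∀ t ∈ A, ¬ t ⊆ s)
    {n m : ℤ} (hnm : m + 1 = n) {x : K.Simplex n →₀ M}
    (hx : ∀ s : K.Simplex n, s.1 ∉ X → x s = 0) (hA : ∀ s ∈ A, s ∈ K.faces) :
    chainRestriction R M K A m (simplicialBoundary R M K n m x) =
      matrixAction R M (faceMatrix A)ᵀ (chainRestriction R M K A n x) := by
  classical
  have key : ∀ s : K.Simplex n, s.1 ∈ X → ∀ y : M,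
      chainRestriction R M K A m (simplicialBoundary R M K n m (Finsupp.single s y)) =
        matrixAction R M (faceMatrix A)ᵀ (chainRestriction R M K A n (Finsupp.single s y)) := by
    intro s hs y
    ext t
    have h1 : matrixAction R M (faceMatrix A)ᵀ
        (chainRestriction R M K A n (Finsupp.single s y)) t = faceCoeff s.1 t.1 • y := by
      change ∑ r : A, faceCoeff r.1 t.1 • extendCochain M K n (Finsupp.single s y) r.1 = _
      simp only [extendCochain_single]
      by_cases h : s.1 ∈ A
      · rw [Finset.sum_eq_single_of_mem (⟨s.1, h⟩ : A) (Finset.mem_univ _), if_pos rfl]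
        intro r _ hr
        rw [if_neg fun h' => hr (Subtype.ext h'.symm), smul_zero]
      · rw [Finset.sum_eq_zero fun r _ => by
          rw [if_neg (show ¬ s.1 = r.1 from fun h' => h (h' ▸ r.2)), smul_zero]]
        -- The restricted chain is zero here, so the boundary must also be invisible on `A`: by
        -- `hX`, `s` has no face in `A`.
        by_cases h0 : faceCoeff s.1 t.1 = 0
        · rw [h0, zero_smul]
        · exact absurd (subset_of_faceCoeff_ne_zero h0) (hX _ hs h _ t.2)
    have h2 : simplicialBoundary R M K n m (Finsupp.single s y) =
        ∑ w ∈ s.1, incidence s.1 w • elementaryChain R M K m (s.1.erase w) y := by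
      simp [simplicialBoundary]
    rw [h1, h2, map_sum, Finset.sum_apply, faceCoeff, Finset.sum_smul]
    refine Finset.sum_congr rfl fun w hw => ?_
    rw [map_zsmul, Pi.smul_apply, ite_smul, zero_smul]
    change incidence s.1 w •
      extendCochain M K m (elementaryChain R M K m (s.1.erase w) y) t.1 = _
    rw [extendCochain_elementaryChain (hA _ t.2) ((simplex_erase s hw).trans hnm.symm),
      smul_ite, smul_zero]
  rw [← Finsupp.sum_single x, Finsupp.sum, map_sum, map_sum, map_sum, map_sum]
  refine Finset.sum_congr rfl fun s hs => key s ?_ _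
  by_contra h
  exact Finsupp.mem_support_iff.mp hs (hx s h)

end Restriction

/-! ### Contractions of the graded pieces of a Morse shelling -/

section Contractions

variable (R : Type w) [CommRing R] (M : Type v) [AddCommGroup M] [Module R M]
  {K : PreAbstractSimplicialComplex V} (S : MorseShelling K)

lemma MorseShelling.mem_chainFiltration_iff {p n : ℤ} {x : K.Simplex n →₀ M} :
    x ∈ S.chainFiltration R M p n ↔
      ∀ s : K.Simplex n, s.1 ∉ (S.subcomplex p).faces → x s = 0 :=
  Finsupp.mem_supported' R x

lemma MorseShelling.mem_cochainFiltration_iff {p n : ℤ} {f : K.Simplex n → M} :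
    f ∈ S.cochainFiltration R M p n ↔
      ∀ s : K.Simplex n, s.1 ∈ (S.subcomplex p).faces → f s = 0 :=
  Iff.rfl

lemma MorseShelling.mem_faces_of_mem_tile (i : Fin S.numTiles) {s : Finset V}
    (hs : s ∈ (S.tile i).faces) : s ∈ K.faces :=
  S.exists_mem_faces_iff.mp ⟨i, hs⟩

lemma MorseShelling.mem_tile_or_mem_subcomplex (i : Fin S.numTiles) {s t : Finset V}
    (hs : s ∈ (S.subcomplex (i + 1)).faces) (ht : t ∈ K.faces) (hts : t ⊆ s)
    (h : t ∉ (S.tile i).faces) : t ∈ (S.subcomplex i).faces := by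
  have := ((S.subcomplex (i + 1)).isRelLowerSet_faces hs).2 hts (K.isRelLowerSet_faces ht).1
  by_contra h'
  exact h ((S.mem_tile_faces_iff i t).mpr ⟨this, h'⟩)

variable (i : Fin S.numTiles) {v : V}

/-- The contraction of the cochains of a tile onto those of its unmatched simplices. -/
def cochainContraction (hv : ∀ s ∈ (S.tile i).faces, insert v s ∈ (S.tile i).faces)
    [Fintype (Unmatched (S.tile i).faces v)] [Subsingleton (Unmatched (S.tile i).faces v)] :
    Contraction (simplicialCochains R M K) (S.cochainFiltration R M) 1 i
      ((S.tile i).faces → M) (Unmatched (S.tile i).faces v → M) where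
  ρ n := cochainRestriction R M K (S.tile i).faces n
  σ n := liftCochain M K (S.tile i).faces n
  component n := homogeneousComponent R M (S.tile i).faces n
  D := matrixAction R M (faceMatrix _)
  H := matrixAction R M (homotopyMatrix _ v)
  α := matrixAction R M (unmatchedCocycle _ v)
  β := matrixAction R M (unmatchedRestriction _ v)
  ρ_eq_zero_iff n x hx := by
    refine (cochainRestriction_eq_zero_iff (R := R)).trans ?_
    refine Iff.trans ?_ (S.mem_cochainFiltration_iff R M).symm
    refine forall_congr' fun s => ⟨fun h hs => ?_, fun h hs => ?_⟩
    · by_cases h' : s.1 ∈ (S.subcomplex i).faces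
      · exact hx s h'
      · exact h ((S.mem_tile_faces_iff i _).mpr ⟨hs, h'⟩)
    · exact h ((S.mem_tile_faces_iff i _).mp hs).1
  ρ_d n m x hnm hx := cochainRestriction_coboundary
    (X := (S.subcomplex i).faces) (fun s hs t ht hts h => S.mem_tile_or_mem_subcomplex i
      ((S.mem_tile_faces_iff i s).mp hs).1 ht hts h) hnm
    ((S.mem_cochainFiltration_iff R M).mp hx) fun s => S.mem_faces_of_mem_tile i
  σ_mem n f := (S.mem_cochainFiltration_iff R M).mpr fun s hs =>
    dif_neg fun h => ((S.mem_tile_faces_iff i _).mp h).2 hs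
  ρ_σ n f := cochainRestriction_liftCochain (fun s => S.mem_faces_of_mem_tile i) n f
  component_ρ n x := homogeneousComponent_cochainRestriction n x
  D_component n f := matrixAction_homogeneousComponent (fun s t h => by
    rw [card_of_faceCoeff_ne_zero h]
    push_cast
    constructor <;> intro h <;> linarith) f
  D_α t := by
    rw [matrixAction_mul, faceMatrix_mul_unmatchedCocycle
      (fun s hs r hr t => MorseTile.mem_faces_of_subset hs hr) hv, matrixAction_zero]
  β_D f := by
    rw [matrixAction_mul, unmatchedRestriction_mul_faceMatrix
      (fun s hs r hr t => MorseTile.mem_faces_of_subset hs hr), matrixAction_zero]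
  β_α t := by
    classical
    rw [matrixAction_mul, unmatchedRestriction_mul_cocycle, matrixAction_one]
  homotopy f := by
    rw [matrixAction_mul, matrixAction_mul, matrixAction_mul, ← matrixAction_add,
      ← matrixAction_add, faceMatrix_homotopy hv, matrixAction_one]

/-- The contraction of the chains of a tile onto those of its unmatched simplices. -/
def chainContraction (hK : K.faces.Finite)
    (hv : ∀ s ∈ (S.tile i).faces, insert v s ∈ (S.tile i).faces)
    [Fintype (Unmatched (S.tile i).faces v)] [Subsingleton (Unmatched (S.tile i).faces v)] :
    Contraction (simplicialChains R M K) (S.chainFiltration R M) (-1) (i + 1)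
      ((S.tile i).faces → M) (Unmatched (S.tile i).faces v → M) where
  ρ n := chainRestriction R M K (S.tile i).faces n
  -- Finiteness of `K` makes every function on simplices a chain.
  σ n f :=
    have : Finite (K.Simplex n) :=
      (hK.subset fun s (hs : s ∈ K.faces ∧ (s.card : ℤ) = n + 1) => hs.1).to_subtype
    Finsupp.equivFunOnFinite.symm (liftCochain M K (S.tile i).faces n f)
  component n := homogeneousComponent R M (S.tile i).faces n
  D := matrixAction R M (faceMatrix _)ᵀ
  H := matrixAction R M (homotopyMatrix _ v)ᵀ
  -- Transposition exchanges the inclusion and the projection: the cocycle matrix now gives the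
  -- projection.
  α := matrixAction R M (unmatchedRestriction _ v)ᵀ
  β := matrixAction R M (unmatchedCocycle _ v)ᵀ
  ρ_eq_zero_iff n x hx := by
    rw [add_neg_cancel_right]
    refine (cochainRestriction_eq_zero_iff (R := R)).trans ?_
    refine Iff.trans ?_ (S.mem_chainFiltration_iff R M).symm
    refine forall_congr' fun s => ⟨fun h hs => ?_, fun h hs => ?_⟩
    · by_cases h' : s.1 ∈ (S.subcomplex (i + 1)).faces
      · exact h ((S.mem_tile_faces_iff i _).mpr ⟨h', hs⟩)
      · exact (S.mem_chainFiltration_iff R M).mp hx s h'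
    · exact h ((S.mem_tile_faces_iff i _).mp hs).2
  -- A simplex of `K_{i+1}` outside the tile lies in the subcomplex `K_i`, so none of its faces is
  -- in the tile.
  ρ_d n m x hnm hx := chainRestriction_boundary
    (X := (S.subcomplex (i + 1)).faces) (fun s hs hsi t ht hts => by
      have h := (S.mem_tile_faces_iff i t).mp ht
      have hs' := S.mem_tile_or_mem_subcomplex i hs hs.1 subset_rfl hsi
      exact h.2 (((S.subcomplex i).isRelLowerSet_faces hs').2 hts
        (MorseTile.nonempty_of_mem_faces ht))) hnm
    ((S.mem_chainFiltration_iff R M).mp hx) fun s => S.mem_faces_of_mem_tile i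
  σ_mem n f := (S.mem_chainFiltration_iff R M).mpr fun s hs =>
    dif_neg fun h => hs ((S.mem_tile_faces_iff i _).mp h).1
  ρ_σ n f := cochainRestriction_liftCochain (fun s => S.mem_faces_of_mem_tile i) n f
  component_ρ n x := homogeneousComponent_cochainRestriction n _
  D_component n f := matrixAction_homogeneousComponent (fun s t h => by
    rw [card_of_faceCoeff_ne_zero h]
    push_cast
    constructor <;> intro h <;> linarith) f
  D_α t := by
    rw [matrixAction_mul, ← Matrix.transpose_mul, unmatchedRestriction_mul_faceMatrix
      (fun s hs r hr t => MorseTile.mem_faces_of_subset hs hr), Matrix.transpose_zero,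
      matrixAction_zero]
  β_D f := by
    rw [matrixAction_mul, ← Matrix.transpose_mul, faceMatrix_mul_unmatchedCocycle
      (fun s hs r hr t => MorseTile.mem_faces_of_subset hs hr) hv, Matrix.transpose_zero,
      matrixAction_zero]
  β_α t := by
    classical
    rw [matrixAction_mul, ← Matrix.transpose_mul, unmatchedRestriction_mul_cocycle,
      Matrix.transpose_one, matrixAction_one]
  homotopy f := by
    rw [matrixAction_mul, matrixAction_mul, matrixAction_mul, ← matrixAction_add,
      ← matrixAction_add, ← Matrix.transpose_mul, ← Matrix.transpose_mul, ← Matrix.transpose_mul,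
      ← Matrix.transpose_add, ← Matrix.transpose_add, add_comm (_ * _) (faceMatrix _ * _),
      faceMatrix_homotopy hv, Matrix.transpose_one, matrixAction_one]

/-- A graded piece which contracts onto the unmatched simplices of a tile contributes, on the first
page, one copy of `M` in the degree of the unmatched simplex, if there is one. -/
lemma FilteredComplex.Contraction.nonempty_page_one_equiv {c : ComplexShape ℤ}
    {C : HomologicalComplex (ModuleCat.{max u v} R) c} {F : ℤ → ∀ n, Submodule R (C.X n)} {ε : ℤ}
    {cc : ℤ → ComplexShape (ℤ × ℤ)} (hc : ∀ i j, c.Rel i j ↔ i + ε = j)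
    (hcc : ∀ r a b, (cc r).Rel a b ↔ a.1 + ε * r = b.1 ∧ a.2 + ε * (1 - r) = b.2)
    (hF : ∀ p n, F (p + ε) n ≤ F p n)
    (hdF : ∀ p n m (x : C.X n), x ∈ F p n → (C.d n m).hom x ∈ F p m)
    {A : Finset (Finset V)} [Subsingleton (Unmatched A v)] {p q : ℤ}
    (G : Contraction C F ε p (A → M) (Unmatched A v → M))
    (hα : ∀ n t, (∀ j : Unmatched A v, (j.1.1.card : ℤ) = n + 1) →
      G.component n (G.α t) = G.α t)
    (hβ : ∀ n f, (∀ j : Unmatched A v, (j.1.1.card : ℤ) ≠ n + 1) →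
      G.β (G.component n f) = 0)
    (I : Type*) [Subsingleton I]
    (hI : Nonempty I ↔ ∃ s ∈ A, s.erase v ∉ A ∧ (s.card : ℤ) = p + q + 1) :
    Nonempty ((page C F ε cc hc hcc 1).X (p, q) ≃ₗ[R] (I →₀ M)) := by
  by_cases h : Nonempty I
  -- Both the index type `I` and the type of unmatched simplices are singletons here, and both sides
  -- are copies of `M`.
  · obtain ⟨s, hs, hsv, hcard⟩ := hI.mp h
    have := uniqueOfSubsingleton (⟨⟨s, hs⟩, hsv⟩ : Unmatched A v)
    obtain ⟨e⟩ := G.page_one_equiv hc hcc hF hdF q fun t => hα _ t fun j => by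
      rw [Subsingleton.elim j ⟨⟨s, hs⟩, hsv⟩]
      exact hcard
    exact ⟨e ≪≫ₗ LinearEquiv.funUnique _ R M ≪≫ₗ
      (Finsupp.uniqueLinearEquiv R M h.some).symm⟩
  · have := G.page_one_subsingleton hc hcc hF hdF q fun f => hβ _ f fun j hj =>
      h (hI.mpr ⟨_, j.1.2, j.2, hj⟩)
    have := not_nonempty_iff.mp h
    exact ⟨LinearEquiv.ofSubsingleton _ _⟩

/-! ### The two filtrations of a shelling and their first pages -/

namespace MorseShelling

lemma chainFiltration_mono {p q : ℤ} (h : p ≤ q) (n : ℤ) :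
    S.chainFiltration R M p n ≤ S.chainFiltration R M q n := fun _ hx =>
  (S.mem_chainFiltration_iff R M).mpr fun s hs =>
    (S.mem_chainFiltration_iff R M).mp hx s fun h' => hs (S.subcomplex_mono h h')

lemma cochainFiltration_anti {p q : ℤ} (h : p ≤ q) (n : ℤ) :
    S.cochainFiltration R M q n ≤ S.cochainFiltration R M p n := fun _ hx s hs =>
  hx s (S.subcomplex_mono h hs)

lemma chainFiltration_eq_bot {p : ℤ} (h : p ≤ 0) (n : ℤ) : S.chainFiltration R M p n = ⊥ := by
  rw [eq_bot_iff]
  intro x hx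
  exact Finsupp.ext fun s =>
    (S.mem_chainFiltration_iff R M).mp hx s (S.notMem_subcomplex_of_nonpos h _)

lemma chainFiltration_eq_top {p : ℤ} (h : S.numTiles ≤ p) (n : ℤ) :
    S.chainFiltration R M p n = ⊤ := by
  rw [eq_top_iff]
  intro x _
  exact (S.mem_chainFiltration_iff R M).mpr fun s hs =>
    absurd (S.mem_subcomplex_of_le h s.2.1) hs

lemma cochainFiltration_eq_top {p : ℤ} (h : p ≤ 0) (n : ℤ) :
    S.cochainFiltration R M p n = ⊤ := by
  rw [eq_top_iff]
  intro x _ s hs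
  exact absurd hs (S.notMem_subcomplex_of_nonpos h _)

lemma cochainFiltration_eq_bot {p : ℤ} (h : S.numTiles ≤ p) (n : ℤ) :
    S.cochainFiltration R M p n = ⊥ := by
  rw [eq_bot_iff]
  intro x hx
  exact funext fun s => hx s (S.mem_subcomplex_of_le h s.2.1)

lemma boundary_mem_chainFiltration (p n m : ℤ) (x : (simplicialChains R M K).X n)
    (hx : x ∈ S.chainFiltration R M p n) :
    ((simplicialChains R M K).d n m).hom x ∈ S.chainFiltration R M p m := by
  change simplicialBoundary R M K n m x ∈ S.chainFiltration R M p m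
  have hx' := (S.mem_chainFiltration_iff R M).mp hx
  rw [← Finsupp.sum_single (show K.Simplex n →₀ M from x), Finsupp.sum, map_sum]
  refine sum_mem fun s hs => ?_
  have hsp : s.1 ∈ (S.subcomplex p).faces := by
    by_contra h
    exact Finsupp.mem_support_iff.mp hs (hx' s h)
  generalize (show K.Simplex n →₀ M from x) s = y
  have h2 : simplicialBoundary R M K n m (Finsupp.single s y) =
      ∑ w ∈ s.1, incidence s.1 w • elementaryChain R M K m (s.1.erase w) y := by
    simp [simplicialBoundary]
  rw [h2]
  refine sum_mem fun w _ => zsmul_mem ?_ _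
  rw [elementaryChain]
  split_ifs with h
  · refine Finsupp.single_mem_supported R y ?_
    exact ((S.subcomplex p).isRelLowerSet_faces hsp).2 (Finset.erase_subset _ _)
      (K.isRelLowerSet_faces h.1).1
  · exact zero_mem _

lemma coboundary_mem_cochainFiltration (p n m : ℤ) (f : (simplicialCochains R M K).X n)
    (hf : f ∈ S.cochainFiltration R M p n) :
    ((simplicialCochains R M K).d n m).hom f ∈ S.cochainFiltration R M p m := by
  intro s hs
  refine Finset.sum_eq_zero fun w _ => ?_
  change incidence s.1 w • extendCochain M K n (show K.Simplex n → M from f) (s.1.erase w) = 0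
  rw [extendCochain]
  split_ifs with h
  · rw [hf _ (((S.subcomplex p).isRelLowerSet_faces hs).2 (Finset.erase_subset _ _)
      (K.isRelLowerSet_faces h.1).1), smul_zero]
  · rw [smul_zero]

/-- Tiles are numbered from zero, so tile `i` carries the piece `F_{i+1} / F_i`; the index type thus
has at most one element. For other `p` the filtration is constant and both sides vanish. -/
lemma nonempty_chain_page_one_equiv (hK : K.faces.Finite)
    (hF : ∀ p n, S.chainFiltration R M (p + -1) n ≤ S.chainFiltration R M p n) (p q : ℤ) :
    Nonempty ((page (simplicialChains R M K) (S.chainFiltration R M) (-1) _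
      ChainComplex.down_rel_iff ChainComplex.page_rel_iff 1).X (p, q) ≃ₗ[R]
        ({i : Fin S.numTiles // (i : ℤ) + 1 = p ∧ (S.tile i).IsCritical (p + q)} →₀ M)) := by
  by_cases h : ∃ i : Fin S.numTiles, (i : ℤ) + 1 = p
  · obtain ⟨i, rfl⟩ := h
    obtain ⟨v, hv, hv', hcrit⟩ := (S.tile i).exists_matching
    have : Subsingleton (Unmatched (S.tile i).faces v) :=
      ⟨fun a b => Subtype.ext (Subtype.ext (hv' _ a.1.2 _ b.1.2 a.2 b.2))⟩
    have : Fintype (Unmatched (S.tile i).faces v) := Fintype.ofFinite _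
    have : Subsingleton {j : Fin S.numTiles // (j : ℤ) + 1 = i + 1 ∧
        (S.tile j).IsCritical (i + 1 + q)} :=
      ⟨fun a b => Subtype.ext (Fin.ext (by have := a.2.1; have := b.2.1; omega))⟩
    refine (chainContraction R M S i hK hv).nonempty_page_one_equiv R M _ _ hF
      (S.boundary_mem_chainFiltration R M) ?_ ?_ _ ?_
    · refine fun n t hn => homogeneousComponent_matrixAction (fun s j hB => ?_) t
      have : j.1 = s := by
        by_contra h
        exact hB (if_neg h)
      rw [← this]
      exact hn j
    · refine fun n f hn => matrixAction_homogeneousComponent_eq_zero (fun j s hB => ?_) f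
      rw [card_eq_of_unmatchedCocycle_ne_zero hB]
      exact hn j
    · rw [← hcrit]
      constructor
      · rintro ⟨j, hj, hj'⟩
        obtain rfl : j = i := Fin.ext (by omega)
        exact hj'
      · exact fun h => ⟨i, rfl, h⟩
  · push Not at h
    have := page_subsingleton (C := simplicialChains R M K) (F := S.chainFiltration R M)
      ChainComplex.down_rel_iff ChainComplex.page_rel_iff 1 (p, q) fun n => by
        refine le_antisymm (hF p n) fun x hx => ?_
        refine (S.mem_chainFiltration_iff R M).mpr fun s hs =>
          (S.mem_chainFiltration_iff R M).mp hx s fun hs' => hs ?_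
        dsimp only at hs' ⊢
        rw [← S.mem_subcomplex_succ_iff fun i hi => h i (by omega), neg_add_cancel_right]
        exact hs'
    have : IsEmpty {i : Fin S.numTiles // (i : ℤ) + 1 = p ∧ (S.tile i).IsCritical (p + q)} :=
      ⟨fun i => h i.1 i.2.1⟩
    exact ⟨LinearEquiv.ofSubsingleton _ _⟩

/-- Relative cochains shift the numbering: tile `i` carries `F^i / F^{i+1}`, so it sits in column
`i` rather than `i + 1`. -/
lemma nonempty_cochain_page_one_equiv
    (hF : ∀ p n, S.cochainFiltration R M (p + 1) n ≤ S.cochainFiltration R M p n) (p q : ℤ) :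
    Nonempty ((page (simplicialCochains R M K) (S.cochainFiltration R M) 1 _
      CochainComplex.up_rel_iff CochainComplex.page_rel_iff 1).X (p, q) ≃ₗ[R]
        ({i : Fin S.numTiles // (i : ℤ) = p ∧ (S.tile i).IsCritical (p + q)} →₀ M)) := by
  by_cases h : ∃ i : Fin S.numTiles, (i : ℤ) = p
  · obtain ⟨i, rfl⟩ := h
    obtain ⟨v, hv, hv', hcrit⟩ := (S.tile i).exists_matching
    have : Subsingleton (Unmatched (S.tile i).faces v) :=
      ⟨fun a b => Subtype.ext (Subtype.ext (hv' _ a.1.2 _ b.1.2 a.2 b.2))⟩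
    have : Fintype (Unmatched (S.tile i).faces v) := Fintype.ofFinite _
    have : Subsingleton {j : Fin S.numTiles // (j : ℤ) = i ∧ (S.tile j).IsCritical (i + q)} :=
      ⟨fun a b => Subtype.ext (Fin.ext (by have := a.2.1; have := b.2.1; omega))⟩
    refine (cochainContraction R M S i hv).nonempty_page_one_equiv R M _ _ hF
      (S.coboundary_mem_cochainFiltration R M) ?_ ?_ _ ?_
    · refine fun n t hn => homogeneousComponent_matrixAction (fun s j hB => ?_) t
      rw [card_eq_of_unmatchedCocycle_ne_zero hB]
      exact hn j
    · refine fun n f hn => matrixAction_homogeneousComponent_eq_zero (fun j s hB => ?_) f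
      have : j.1 = s := by
        by_contra h
        exact hB (if_neg h)
      rw [← this]
      exact hn j
    · rw [← hcrit]
      constructor
      · rintro ⟨j, hj, hj'⟩
        obtain rfl : j = i := Fin.ext (by omega)
        exact hj'
      · exact fun h => ⟨i, rfl, h⟩
  · push Not at h
    have := page_subsingleton (C := simplicialCochains R M K) (F := S.cochainFiltration R M)
      CochainComplex.up_rel_iff CochainComplex.page_rel_iff 1 (p, q) fun n =>
        le_antisymm (hF p n) fun f hf s hs => hf s ((S.mem_subcomplex_succ_iff h _).mp hs)
    have : IsEmpty {i : Fin S.numTiles // (i : ℤ) = p ∧ (S.tile i).IsCritical (p + q)} :=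
      ⟨fun i => h i.1 i.2.1⟩
    exact ⟨LinearEquiv.ofSubsingleton _ _⟩

end MorseShelling

end Contractions

end TileContraction

end

theorem theorem1p2 {V : Type u} [LinearOrder V] (R : Type w) [CommRing R]
    (M : Type v) [AddCommGroup M] [Module R M]
    (K : PreAbstractSimplicialComplex V) (hK : K.faces.Finite) (S : MorseShelling K) :
    (∃ E : HomologicalSpectralSequence (ModuleCat.{max u v} R) 0,
      Nonempty (ChainComplex.InducedBy (simplicialChains R M K) (S.chainFiltration R M) E) ∧
      HomologicalConvergence E S.numTiles (fun n => (simplicialChains R M K).homology n)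
        (homologyFiltration (simplicialChains R M K) (S.chainFiltration R M)) ∧
      ∀ p q : ℤ, Nonempty ((E.page 1 zero_le_one).X (p, q) ≃ₗ[R]
        ({i : Fin S.numTiles // (i : ℤ) + 1 = p ∧ (S.tile i).IsCritical (p + q)} →₀ M))) ∧
    (∃ E : CohomologicalSpectralSequence (ModuleCat.{max u v} R) 0,
      Nonempty (CochainComplex.InducedBy (simplicialCochains R M K) (S.cochainFiltration R M) E) ∧
      CohomologicalConvergence E S.numTiles (fun n => (simplicialCochains R M K).homology n)
        (homologyFiltration (simplicialCochains R M K) (S.cochainFiltration R M)) ∧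
      ∀ p q : ℤ, Nonempty ((E.page 1 zero_le_one).X (p, q) ≃ₗ[R]
        ({i : Fin S.numTiles // (i : ℤ) = p ∧ (S.tile i).IsCritical (p + q)} →₀ M))) := by
  have hF : ∀ p n, S.chainFiltration R M (p + -1) n ≤ S.chainFiltration R M p n :=
    fun p => S.chainFiltration_mono R M (by omega)
  have hF' : ∀ p n, S.cochainFiltration R M (p + 1) n ≤ S.cochainFiltration R M p n :=
    fun p => S.cochainFiltration_anti R M (by omega)
  exact ⟨⟨_, ⟨ChainComplex.inducedBySpectralSequence _ hF⟩,
      ChainComplex.homologicalConvergence_spectralSequence _ hF _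
        (fun _ n h => S.chainFiltration_eq_bot R M h n)
        (fun _ n h => S.chainFiltration_eq_top R M h n),
      S.nonempty_chain_page_one_equiv R M hK hF⟩,
    ⟨_, ⟨CochainComplex.inducedBySpectralSequence _ hF'⟩,
      CochainComplex.cohomologicalConvergence_spectralSequence _ hF' _
        (fun _ n h => S.cochainFiltration_eq_top R M h n)
        (fun _ n h => S.cochainFiltration_eq_bot R M h n),
      S.nonempty_cochain_page_one_equiv R M hF'⟩⟩
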